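/- **Theorem 1.6.** Let $d\ge 1$ and $\lambda>0$. Let $\{x_i: i\ge 1\}$ be a stationary Poisson point process of intensity $\lambda$ on $\mathbb{R}^d$, and let $\rho_1,\rho_2,\dots$ be i.i.d. positive random variables, independent of $\{x_i : i\ge 1\}$, such that $E\rho_1^{d+\eta}<\infty$ for some $\eta>0$. Let $h:[0,\infty)\to(0,\infty)$ be nondecreasing, and let $$C=\bigcup_{i=1}^{\infty} B\bigl(x_i,\ \rho_i\,h(\|x_i\|)\bigr),$$ where $\|\cdot\|$ is the Euclidean norm and $B(x,r)$ is the ball with centre $x$ and radius $r$ (all balls are open, or all are closed; the result holds under either convention). Let $\pi_d$ be the volume of the unit ball of $\mathbb{R}^d$ and, for $r>1$, let $h_0(r)=\left(\frac{d}{\lambda\pi_d}\log r\right)^{1/d}$. (a) If $l_h:=\liminf_{r\to\infty}\left(\frac{h(r)}{h_0(r)}\right)^d>\frac{1}{E(\rho_1^d)}$ (the case $l_h=\infty$ is allowed), then $P(C=\mathbb{R}^d)>0$. (b) If $L_h:=\limsup_{r\to\infty}\left(\frac{h(r)}{h_0(r)}\right)^d<\frac{1}{E(\rho_1^d)}$,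 then $P(C=\mathbb{R}^d)=0$. -/

import Mathlib

open MeasureTheory ProbabilityTheory Filter

/-- The number (possibly infinite, counted with multiplicity) of the points `X 0 ω, X 1 ω, …`
that lie in the set `A`. -/
noncomputable def pointCount {Ω E : Type*} (X : ℕ → Ω → E) (A : Set E) (ω : Ω) : ℕ∞ :=
  {i : ℕ | X i ω ∈ A}.encard

/-- The random points `X 0, X 1, …` form (an enumeration of) a Poisson point process on `E` with
intensity measure `ν`: the number of points in a measurable set `A` with `ν A < ∞` is Poisson
distributed with mean `ν A`, and the numbers of points in finitely many pairwise disjoint such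
sets are independent. -/
structure IsPoissonPointProcess {Ω E : Type*} [MeasurableSpace Ω] [MeasurableSpace E]
    (X : ℕ → Ω → E) (ν : Measure E) (P : Measure Ω) : Prop where
  measurable : ∀ i, Measurable (X i)
  count_law : ∀ A : Set E, MeasurableSet A → ν A < ⊤ →
    P.map (pointCount X A) = (poissonMeasure (ν A).toNNReal).map (fun k : ℕ => (k : ℕ∞))
  count_indep : ∀ (n : ℕ) (A : Fin n → Set E), (∀ j, MeasurableSet (A j)) →
    (∀ j, ν (A j) < ⊤) → Pairwise (fun j k => Disjoint (A j) (A k)) →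
    iIndepFun (fun j => pointCount X (A j)) P

/-- The marks `ρ 0, ρ 1, …` are i.i.d. almost surely positive random variables, and the sequence
of marks is independent of the sequence of points `X 0, X 1, …`. -/
structure IsIIDPositiveMarks {Ω E : Type*} [MeasurableSpace Ω] [MeasurableSpace E]
    (ρ : ℕ → Ω → ℝ) (X : ℕ → Ω → E) (P : Measure Ω) : Prop where
  measurable : ∀ i, Measurable (ρ i)
  pos : ∀ i, ∀ᵐ ω ∂P, 0 < ρ i ω
  indep : iIndepFun ρ P
  identDistrib : ∀ i, IdentDistrib (ρ i) (ρ 0) P P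
  indep_points : IndepFun (fun ω i => X i ω) (fun ω i => ρ i ω) P

/-- The volume `π_d` of a ball of unit radius in `d`-dimensional Euclidean space. -/
noncomputable def unitBallVolume (d : ℕ) : ℝ :=
  (volume (Metric.ball (0 : EuclideanSpace ℝ (Fin d)) 1)).toReal

/-- `h₀(r) = (d / (λ π_d) * log r) ^ (1 / d)`; only the values at large `r` matter. -/
noncomputable def hZero (d : ℕ) (lam r : ℝ) : ℝ :=
  ((d : ℝ) / (lam * unitBallVolume d) * Real.log r) ^ (1 / (d : ℝ))

/-- The covered region: the union over `i` of the balls `B(X i, ρ i * h ‖X i‖)`. Here `B x r` is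
the ball of centre `x` and radius `r`; taking it as an argument allows for open balls as well as
for closed ones. -/
def coveredRegion {Ω : Type*} {d : ℕ}
    (B : EuclideanSpace ℝ (Fin d) → ℝ → Set (EuclideanSpace ℝ (Fin d))) (h : ℝ → ℝ)
    (X : ℕ → Ω → EuclideanSpace ℝ (Fin d)) (ρ : ℕ → Ω → ℝ) (ω : Ω) :
    Set (EuclideanSpace ℝ (Fin d)) :=
  ⋃ i : ℕ, B (X i ω) (ρ i ω * h ‖X i ω‖)

open scoped ENNReal NNReal Topology

/-! A point `y` is covered exactly when some marked point `(x, r)` falls in a set attached to `y`,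
so coverage concerns avoidance of sets by the marked process. That process avoids `S` with
probability `exp (-m S)`, where `m` is the product of `lam` times Lebesgue measure and the law of a
mark (`IsPoissonPointProcess.hasPoissonVoids`). If `h r ^ d` is about `a * log r`, the set attached
to a point at distance `r` from the origin has intensity about `κ * log r`, where `κ = lam * π_d * a
* E(ρ ^ d)`, and is avoided with probability about `r ^ (-κ)`. Summed over the integer lattice,
these probabilities converge or diverge according to whether `κ > d` or `κ < d`. With `a = c * d /
(lam * π_d)` the threshold is `c = 1 / E(ρ ^ d)`.

Above the threshold, outside a finite set of lattice points the failure probabilities sum to less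
than one. The bounded region that remains is covered if finitely many small disjoint tiles are all
hit, an event of positive probability. The two requirements are compatible because avoiding one set
is negatively correlated with hitting the tiles
(`HasPoissonVoids.measure_void_inter_iInter_compl_le`).

Below the threshold, take a grid of mesh `n` in a box of side `n ^ (q + 1)`. For large `q` the
expected number of uncovered grid points tends to infinity. Two of these events are correlated by
the factor `exp` of the intensity of the overlap of their sets. An overlap needs a ball of
exceptional radius, and the moment of order `d + η` makes its intensity tend to zero. The second
moment method (`measureReal_iInter_compl_le`) then shows that some grid point is uncovered with
probability tending to one. -/

theorem lintegral_pow_poissonMeasure (r : ℝ≥0) {s : ℝ} (hs : 0 ≤ s) :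
    ∫⁻ n : ℕ, ENNReal.ofReal s ^ n ∂(poissonMeasure r)
      = ENNReal.ofReal (Real.exp (-((1 - s) * r))) := by
  have hsum : HasSum (fun n : ℕ => Real.exp (-r) * r ^ n / n.factorial * s ^ n)
      (Real.exp (-((1 - s) * r))) := by
    have h1 := (NormedSpace.expSeries_div_hasSum_exp ((r : ℝ) * s)).mul_left (Real.exp (-r))
    rw [← Real.exp_eq_exp_ℝ, ← Real.exp_add] at h1
    have h2 : ∀ n : ℕ, Real.exp (-r) * r ^ n / n.factorial * s ^ n
        = Real.exp (-r) * (((r : ℝ) * s) ^ n / n.factorial) := fun n => by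
      rw [mul_pow]
      ring
    have h3 : -((1 - s) * (r : ℝ)) = -r + r * s := by ring
    simp_rw [h2, h3]
    exact h1
  rw [poissonMeasure, lintegral_sum_measure, ← hsum.tsum_eq,
    ENNReal.ofReal_tsum_of_nonneg (fun n => by positivity) hsum.summable]
  refine tsum_congr fun n => ?_
  rw [lintegral_smul_measure, lintegral_dirac, smul_eq_mul, ← ENNReal.ofReal_pow hs,
    ← ENNReal.ofReal_mul (by positivity)]

/-- Needed because the point counts are only known to be a.e. measurable. -/
theorem iIndepFun.lintegral_prod_of_aemeasurable {Ω ι : Type*} [MeasurableSpace Ω]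
    {P : Measure Ω} [Countable ι] (s : Finset ι) (f : ι → Ω → ℝ≥0∞) (hf : iIndepFun f P)
    (hm : ∀ i, AEMeasurable (f i) P) :
    ∫⁻ ω, ∏ i ∈ s, f i ω ∂P = ∏ i ∈ s, ∫⁻ ω, f i ω ∂P := by
  have h1 : iIndepFun (fun i => (hm i).mk (f i)) P := hf.congr fun i => (hm i).ae_eq_mk
  have h2 := lintegral_prod_eq_prod_lintegral_of_indepFun s _ h1 fun i => (hm i).measurable_mk
  have h3 : ∀ᵐ ω ∂P, ∀ i, f i ω = (hm i).mk (f i) ω := ae_all_iff.2 fun i => (hm i).ae_eq_mk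
  rw [lintegral_congr_ae (h3.mono fun ω h => Finset.prod_congr rfl fun i _ => h i), h2]
  exact Finset.prod_congr rfl fun i _ => lintegral_congr_ae (hm i).ae_eq_mk.symm

/-! ### Generating functional of a Poisson process -/

section GeneratingFunctional

variable {Ω E : Type*}

/-- The infinite product of `1 - g (X i)` as a decreasing limit of finite products. -/
noncomputable def survivalProduct (X : ℕ → Ω → E) (g : E → ℝ≥0∞) (ω : Ω) : ℝ≥0∞ :=
  ⨅ m : ℕ, ∏ i ∈ Finset.range m, (1 - g (X i ω))

theorem antitone_prod_one_sub (g : ℕ → ℝ≥0∞) :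
    Antitone fun m : ℕ => ∏ i ∈ Finset.range m, (1 - g i) := by
  refine antitone_nat_of_succ_le fun m => ?_
  rw [Finset.prod_range_succ]
  exact mul_le_of_le_one_right zero_le tsub_le_self

/-- Points with `g = 0` contribute factors 1 and only finitely many others exist, so the partial
products are eventually constant and can be regrouped by the value of `g`. -/
theorem survivalProduct_simple {X : ℕ → Ω → E} {n : ℕ} (g : E → ℝ≥0∞) (v : Fin n → ℝ≥0∞)
    (hv : Function.Injective v) (hg : ∀ x, g x ≠ 0 → ∃ j, g x = v j) (hv0 : ∀ j, v j ≠ 0) (ω : Ω)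
    (hfin : ∀ j, pointCount X (g ⁻¹' {v j}) ω < ⊤) :
    survivalProduct X g ω = ∏ j, (1 - v j) ^ (pointCount X (g ⁻¹' {v j}) ω).toNat := by
  classical
  have hpt : ∀ x, 1 - g x = ∏ j, (1 - v j) ^ (if g x = v j then 1 else 0) := by
    intro x
    by_cases hx : g x = 0
    · rw [hx, Finset.prod_eq_one]
      · simp
      · intro j _
        rw [if_neg (fun h => hv0 j h.symm), pow_zero]
    · obtain ⟨j, hj⟩ := hg x hx
      rw [Finset.prod_eq_single j]
      · simp [hj]
      · intro k _ hk
        rw [if_neg, pow_zero]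
        intro h
        exact hk (hv (h.symm.trans hj))
      · simp
  have hprod : ∀ m, ∏ i ∈ Finset.range m, (1 - g (X i ω))
      = ∏ j, (1 - v j) ^ ((Finset.range m).filter fun i => g (X i ω) = v j).card := by
    intro m
    simp_rw [hpt]
    rw [Finset.prod_comm]
    refine Finset.prod_congr rfl fun j _ => ?_
    rw [Finset.prod_pow_eq_pow_sum, Finset.card_filter]
  have hfin' : ∀ j, {i : ℕ | X i ω ∈ g ⁻¹' {v j}}.Finite := fun j =>
    Set.encard_lt_top_iff.1 (hfin j)
  have hcount : ∀ j, (pointCount X (g ⁻¹' {v j}) ω).toNat = (hfin' j).toFinset.card := by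
    intro j
    rw [pointCount, (hfin' j).encard_eq_coe_toFinset_card, ENat.toNat_natCast]
  simp_rw [hcount]
  obtain ⟨M, hM⟩ : ∃ M : ℕ, ∀ j, ∀ i ∈ (hfin' j).toFinset, i < M := by
    refine ⟨(Finset.univ.biUnion fun j => (hfin' j).toFinset).sup id + 1, fun j i hi => ?_⟩
    refine Nat.lt_succ_of_le (Finset.le_sup (f := id) ?_)
    exact Finset.mem_biUnion.2 ⟨j, Finset.mem_univ _, hi⟩
  refine le_antisymm ((iInf_le _ M).trans ?_) (le_iInf fun m => ?_)
  · rw [hprod]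
    refine Finset.prod_le_prod' fun j _ => ?_
    refine pow_le_pow_right_of_le_one' tsub_le_self (Finset.card_le_card fun i hi => ?_)
    exact Finset.mem_filter.2 ⟨Finset.mem_range.2 (hM j i hi), by simpa using hi⟩
  · rw [hprod]
    refine Finset.prod_le_prod' fun j _ => ?_
    refine pow_le_pow_right_of_le_one' tsub_le_self (Finset.card_le_card fun i hi => ?_)
    simpa using (Finset.mem_filter.1 hi).2

variable [MeasurableSpace Ω] [MeasurableSpace E] {P : Measure Ω} {X : ℕ → Ω → E} {ν : Measure E}

/-- The push-forward along a map that is not a.e. measurable is 0 by convention, whereas here it is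
a probability measure. -/
theorem IsPoissonPointProcess.aemeasurable_pointCount (hX : IsPoissonPointProcess X ν P)
    {A : Set E} (hA : MeasurableSet A) (hν : ν A < ⊤) : AEMeasurable (pointCount X A) P := by
  refine AEMeasurable.of_map_ne_zero ?_
  rw [hX.count_law A hA hν]
  exact IsProbabilityMeasure.ne_zero _

theorem IsPoissonPointProcess.pointCount_lt_top (hX : IsPoissonPointProcess X ν P)
    {A : Set E} (hA : MeasurableSet A) (hν : ν A < ⊤) : ∀ᵐ ω ∂P, pointCount X A ω < ⊤ := by
  have h1 : P.map (pointCount X A) {⊤} = 0 := by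
    rw [hX.count_law A hA hν, Measure.map_apply .of_discrete (MeasurableSet.of_discrete)]
    have h2 : (fun k : ℕ => (k : ℕ∞)) ⁻¹' {⊤} = ∅ := by
      ext k
      simp
    rw [h2, measure_empty]
  rw [Measure.map_apply_of_aemeasurable (hX.aemeasurable_pointCount hA hν)
    (MeasurableSet.of_discrete)] at h1
  filter_upwards [measure_eq_zero_iff_ae_notMem.1 h1] with ω hω
  exact lt_top_iff_ne_top.2 hω

theorem IsPoissonPointProcess.lintegral_pow_pointCount (hX : IsPoissonPointProcess X ν P)
    {A : Set E} (hA : MeasurableSet A) (hν : ν A < ⊤) {s : ℝ} (hs : 0 ≤ s) :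
    ∫⁻ ω, ENNReal.ofReal s ^ (pointCount X A ω).toNat ∂P
      = ENNReal.ofReal (Real.exp (-((1 - s) * (ν A).toReal))) := by
  have h1 := lintegral_map' (μ := P) (f := fun k : ℕ∞ => ENNReal.ofReal s ^ k.toNat)
    (Measurable.of_discrete).aemeasurable (hX.aemeasurable_pointCount hA hν)
  rw [← h1, hX.count_law A hA hν, lintegral_map .of_discrete .of_discrete]
  exact lintegral_pow_poissonMeasure (ν A).toNNReal hs

theorem measurable_survivalProduct (hX : ∀ i, Measurable (X i)) {g : E → ℝ≥0∞}
    (hg : Measurable g) : Measurable (survivalProduct X g) :=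
  Measurable.iInf fun _ => Finset.measurable_prod _ fun i _ =>
    measurable_const.sub (hg.comp (hX i))

/-- The counts on the disjoint level sets are independent, so the expectation factors into Poisson
generating functions. -/
theorem IsPoissonPointProcess.lintegral_survivalProduct_simple
    (hX : IsPoissonPointProcess X ν P) (g : SimpleFunc E ℝ≥0∞) (hg1 : ∀ x, g x ≤ 1)
    (hg : ∫⁻ x, g x ∂ν ≠ ⊤) :
    ∫⁻ ω, survivalProduct X g ω ∂P = ENNReal.ofReal (Real.exp (-(∫⁻ x, g x ∂ν).toReal)) := by
  classical
  -- The value 0 is left out: its level set may have infinite intensity.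
  let I : Finset ℝ≥0∞ := g.range.filter (· ≠ 0)
  let e := I.equivFin.symm
  let v : Fin I.card → ℝ≥0∞ := fun j => (e j : ℝ≥0∞)
  have hvI : ∀ j, v j ∈ g.range ∧ v j ≠ 0 := fun j => Finset.mem_filter.1 (e j).2
  have hv : Function.Injective v := Subtype.val_injective.comp e.injective
  have hv0 : ∀ j, v j ≠ 0 := fun j => (hvI j).2
  have hv1 : ∀ j, v j ≤ 1 := by
    intro j
    obtain ⟨x, hx⟩ := SimpleFunc.mem_range.1 (hvI j).1
    exact hx ▸ hg1 x
  have hgv : ∀ x, g x ≠ 0 → ∃ j, g x = v j := by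
    intro x hx
    refine ⟨e.symm ⟨g x, Finset.mem_filter.2 ⟨SimpleFunc.mem_range_self g x, hx⟩⟩, ?_⟩
    simp [v]
  have hA : ∀ j, MeasurableSet (g ⁻¹' {v j}) := fun j => g.measurableSet_preimage _
  have hν : ∀ j, ν (g ⁻¹' {v j}) < ⊤ := by
    intro j
    have h1 := mul_meas_ge_le_lintegral (μ := ν) g.measurable (v j)
    have h2 : ν (g ⁻¹' {v j}) ≤ ν {x | v j ≤ g x} := measure_mono fun x hx => (le_of_eq
      (Set.mem_singleton_iff.1 hx).symm)
    refine h2.trans_lt ?_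
    by_contra h3
    rw [not_lt, top_le_iff] at h3
    rw [h3, ENNReal.mul_top (hv0 j), top_le_iff] at h1
    exact hg h1
  have hfin : ∀ᵐ ω ∂P, ∀ j, pointCount X (g ⁻¹' {v j}) ω < ⊤ :=
    ae_all_iff.2 fun j => hX.pointCount_lt_top (hA j) (hν j)
  rw [lintegral_congr_ae (hfin.mono fun ω h => survivalProduct_simple g v hv hgv hv0 ω h)]
  have hind := hX.count_indep _ _ hA hν (by
    intro j k hjk
    exact Disjoint.preimage _ (by simpa using hv.ne hjk))
  have hind2 := hind.comp (fun j (k : ℕ∞) => (1 - v j) ^ k.toNat) (fun j => .of_discrete)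
  have h4 := iIndepFun.lintegral_prod_of_aemeasurable Finset.univ _ hind2 (fun j =>
    (Measurable.of_discrete (f := fun k : ℕ∞ => (1 - v j) ^ k.toNat)).comp_aemeasurable
      (hX.aemeasurable_pointCount (hA j) (hν j)))
  simp only [Function.comp_apply] at h4
  rw [h4]
  have h5 : ∀ j, ∫⁻ ω, (1 - v j) ^ (pointCount X (g ⁻¹' {v j}) ω).toNat ∂P
      = ENNReal.ofReal (Real.exp (-((v j).toReal * (ν (g ⁻¹' {v j})).toReal))) := by
    intro j
    have hvt : v j ≠ ⊤ := ((hv1 j).trans_lt ENNReal.one_lt_top).ne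
    have h6 : (1 - v j) = ENNReal.ofReal (1 - (v j).toReal) := by
      rw [ENNReal.ofReal_sub _ ENNReal.toReal_nonneg, ENNReal.ofReal_one,
        ENNReal.ofReal_toReal hvt]
    rw [h6, hX.lintegral_pow_pointCount (hA j) (hν j)]
    · simp
    · have := ENNReal.toReal_mono ENNReal.one_ne_top (hv1 j)
      simp at this
      linarith
  simp_rw [h5]
  rw [← ENNReal.ofReal_prod_of_nonneg (fun _ _ => (Real.exp_pos _).le), ← Real.exp_sum,
    Finset.sum_neg_distrib]
  congr 3
  rw [SimpleFunc.lintegral_eq_lintegral, SimpleFunc.lintegral]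
  have h7 : ∑ x ∈ g.range, x * ν (g ⁻¹' {x}) = ∑ j, v j * ν (g ⁻¹' {v j}) := by
    rw [← Finset.sum_filter_add_sum_filter_not g.range (· ≠ 0), Finset.sum_eq_zero (s := g.range.filter (¬ · ≠ 0)),
      add_zero, ← Finset.sum_coe_sort, ← Equiv.sum_comp e]
    intro x hx
    rw [not_not.1 (Finset.mem_filter.1 hx).2, zero_mul]
  rw [h7, ENNReal.toReal_sum]
  · simp
  · intro j _
    exact ENNReal.mul_ne_top ((hv1 j).trans_lt ENNReal.one_lt_top).ne (hν j).ne

/-- The generating functional of a Poisson point process. -/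
theorem IsPoissonPointProcess.lintegral_survivalProduct
    (hX : IsPoissonPointProcess X ν P) {g : E → ℝ≥0∞} (hgm : Measurable g) (hg1 : ∀ x, g x ≤ 1)
    (hg : ∫⁻ x, g x ∂ν ≠ ⊤) :
    ∫⁻ ω, survivalProduct X g ω ∂P = ENNReal.ofReal (Real.exp (-(∫⁻ x, g x ∂ν).toReal)) := by
  -- As the simple functions increase to `g`, the survival products decrease, so monotone
  -- convergence applies on both sides.
  let s : ℕ → SimpleFunc E ℝ≥0∞ := SimpleFunc.eapprox g
  have hsg : ∀ n x, s n x ≤ g x := fun n x => by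
    rw [← SimpleFunc.iSup_eapprox_apply hgm x]
    exact le_iSup (fun n => s n x) n
  have hmono : Monotone s := SimpleFunc.monotone_eapprox g
  have hanti : Antitone fun n => survivalProduct X (s n) := by
    intro n k hnk ω
    refine iInf_mono fun m => Finset.prod_le_prod' fun i _ => ?_
    exact tsub_le_tsub_left (hmono hnk _) _
  have hlim : ∀ ω, survivalProduct X g ω = ⨅ n, survivalProduct X (s n) ω := by
    intro ω
    simp only [survivalProduct]
    rw [iInf_comm]
    refine iInf_congr fun m => ?_
    have h1 : Tendsto (fun n => ∏ i ∈ Finset.range m, (1 - s n (X i ω))) atTop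
        (𝓝 (∏ i ∈ Finset.range m, (1 - g (X i ω)))) := by
      refine ENNReal.tendsto_finsetProd_of_ne_top _ (fun i _ => ?_) (fun i _ => by simp)
      exact ENNReal.Tendsto.sub tendsto_const_nhds (SimpleFunc.tendsto_eapprox hgm _)
        (Or.inl ENNReal.one_ne_top)
    refine tendsto_nhds_unique h1 (tendsto_atTop_iInf fun n k hnk => ?_)
    exact Finset.prod_le_prod' fun i _ => tsub_le_tsub_left (hmono hnk _) _
  have hint : ∫⁻ x, g x ∂ν = ⨆ n, ∫⁻ x, s n x ∂ν := by
    rw [← lintegral_iSup (fun n => (s n).measurable) (fun n k hnk x => hmono hnk x)]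
    exact lintegral_congr fun x => (SimpleFunc.iSup_eapprox_apply hgm x).symm
  have hfin : ∀ n, ∫⁻ x, s n x ∂ν ≠ ⊤ := fun n =>
    ((lintegral_mono (hsg n)).trans_lt (lt_top_iff_ne_top.2 hg)).ne
  simp_rw [hlim]
  rw [lintegral_iInf (fun n => measurable_survivalProduct hX.measurable (s n).measurable) hanti]
  · have h1 : Tendsto (fun n => ∫⁻ ω, survivalProduct X (s n) ω ∂P) atTop
        (𝓝 (⨅ n, ∫⁻ ω, survivalProduct X (s n) ω ∂P)) :=
      tendsto_atTop_iInf fun n k hnk => lintegral_mono (hanti hnk)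
    refine tendsto_nhds_unique h1 ?_
    have h2 : Tendsto (fun n => ∫⁻ x, s n x ∂ν) atTop (𝓝 (∫⁻ x, g x ∂ν)) := by
      rw [hint]
      exact tendsto_atTop_iSup fun n k hnk => lintegral_mono (hmono hnk)
    have h3 := (ENNReal.tendsto_toReal hg).comp h2
    refine (ENNReal.tendsto_ofReal ((Real.continuous_exp.tendsto _).comp h3.neg)).congr fun n => ?_
    rw [hX.lintegral_survivalProduct_simple (s n) (fun x => (hsg n x).trans (hg1 x)) (hfin n)]
    rfl
  · rw [hX.lintegral_survivalProduct_simple (s 0) (fun x => (hsg 0 x).trans (hg1 x)) (hfin 0)]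
    exact ENNReal.ofReal_ne_top

end GeneratingFunctional

/-! ### Avoidance probabilities and their correlations -/

section Void

variable {Ω F : Type*}

/-- The event that none of the points `Z 0, Z 1, …` lies in `S`. -/
def voidEvent (Z : ℕ → Ω → F) (S : Set F) : Set Ω := {ω | ∀ i, Z i ω ∉ S}

theorem voidEvent_eq_iInter (Z : ℕ → Ω → F) (S : Set F) :
    voidEvent Z S = ⋂ i, (Z i ⁻¹' S)ᶜ := by
  ext ω
  simp [voidEvent]

theorem voidEvent_biUnion {ι : Type*} (Z : ℕ → Ω → F) (s : Finset ι) (A : ι → Set F) :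
    voidEvent Z (⋃ i ∈ s, A i) = ⋂ i ∈ s, voidEvent Z (A i) := by
  ext ω
  simp only [voidEvent, Set.mem_ofPred_eq, Set.mem_iUnion, Set.mem_iInter, not_exists]
  exact ⟨fun h i hi n => h n i hi, fun h n i hi => h i hi n⟩

theorem voidEvent_union (Z : ℕ → Ω → F) (S T : Set F) :
    voidEvent Z (S ∪ T) = voidEvent Z S ∩ voidEvent Z T := by
  ext ω
  simp [voidEvent, forall_and]

theorem voidEvent_anti (Z : ℕ → Ω → F) {S T : Set F} (h : S ⊆ T) :
    voidEvent Z T ⊆ voidEvent Z S := fun _ hω i hi => hω i (h hi)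

variable [MeasurableSpace Ω] [MeasurableSpace F]

/-- The avoidance probabilities of `Z` are those of a Poisson process of intensity `m`. -/
structure HasPoissonVoids (Z : ℕ → Ω → F) (m : Measure F) (P : Measure Ω) : Prop where
  measurable : ∀ i, Measurable (Z i)
  measure_void : ∀ S : Set F, MeasurableSet S → m S ≠ ⊤ →
    P (voidEvent Z S) = ENNReal.ofReal (Real.exp (-(m S).toReal))

namespace HasPoissonVoids

variable {Z : ℕ → Ω → F} {m : Measure F} {P : Measure Ω}

theorem measurableSet_voidEvent (hZ : HasPoissonVoids Z m P) {S : Set F} (hS : MeasurableSet S) :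
    MeasurableSet (voidEvent Z S) := by
  rw [voidEvent_eq_iInter]
  exact MeasurableSet.iInter fun i => (hZ.measurable i hS).compl

theorem measureReal_void (hZ : HasPoissonVoids Z m P) {S : Set F} (hS : MeasurableSet S)
    (hm : m S ≠ ⊤) : P.real (voidEvent Z S) = Real.exp (-m.real S) := by
  rw [measureReal_def, hZ.measure_void S hS hm, ENNReal.toReal_ofReal (Real.exp_pos _).le]
  rfl

/-- Inclusion–exclusion for `m`: the correlation of two avoidance events depends only on the overlap
of the sets. -/
theorem measureReal_void_inter (hZ : HasPoissonVoids Z m P) {S T : Set F} (hS : MeasurableSet S)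
    (hT : MeasurableSet T) (hmS : m S ≠ ⊤) (hmT : m T ≠ ⊤) :
    P.real (voidEvent Z S ∩ voidEvent Z T)
      = Real.exp (m.real (S ∩ T)) * P.real (voidEvent Z S) * P.real (voidEvent Z T) := by
  rw [← voidEvent_union, hZ.measureReal_void (hS.union hT) (measure_union_ne_top hmS hmT),
    hZ.measureReal_void hS hmS, hZ.measureReal_void hT hmT, ← Real.exp_add, ← Real.exp_add]
  have := measureReal_union_add_inter (μ := m) (s := S) hT hmS hmT
  congr 1
  linarith

/-- Intensities of disjoint sets add, so avoidance probabilities multiply. -/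
theorem iIndepSet_void [IsProbabilityMeasure P] (hZ : HasPoissonVoids Z m P) {ι : Type*}
    (A : ι → Set F) (hA : ∀ i, MeasurableSet (A i)) (hm : ∀ i, m (A i) ≠ ⊤)
    (hd : Pairwise fun i j => Disjoint (A i) (A j)) :
    iIndepSet (fun i => voidEvent Z (A i)) P := by
  rw [iIndepSet_iff_meas_biInter fun i => hZ.measurableSet_voidEvent (hA i)]
  intro s
  have hU : m (⋃ i ∈ s, A i) = ∑ i ∈ s, m (A i) :=
    measure_biUnion_finset (fun i _ j _ hij => hd hij) fun i _ => hA i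
  rw [← voidEvent_biUnion, hZ.measure_void _ (Finset.measurableSet_biUnion s fun i _ => hA i), hU,
    ENNReal.toReal_sum fun i _ => hm i, ← Finset.sum_neg_distrib, Real.exp_sum,
    ENNReal.ofReal_prod_of_nonneg fun _ _ => (Real.exp_pos _).le]
  · exact Finset.prod_congr rfl fun i _ => (hZ.measure_void _ (hA i) (hm i)).symm
  · rw [hU]
    exact ENNReal.sum_ne_top.2 fun i _ => hm i

theorem measure_iInter_compl_void [IsProbabilityMeasure P] (hZ : HasPoissonVoids Z m P)
    {ι : Type*} [Fintype ι] (A : ι → Set F) (hA : ∀ i, MeasurableSet (A i))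
    (hm : ∀ i, m (A i) ≠ ⊤) (hd : Pairwise fun i j => Disjoint (A i) (A j)) :
    P (⋂ i, (voidEvent Z (A i))ᶜ) = ∏ i, P (voidEvent Z (A i))ᶜ :=
  ((iIndepSet_iff_iIndep _ _).1 (hZ.iIndepSet_void A hA hm hd)).meas_iInter fun _ =>
    (MeasurableSpace.measurableSet_generateFrom (Set.mem_singleton _)).compl

/-- Avoiding `S` is negatively correlated with hitting each of the disjoint sets `A i`. -/
theorem measure_void_inter_iInter_compl_le [IsProbabilityMeasure P] (hZ : HasPoissonVoids Z m P)
    {ι : Type*} [Fintype ι] (A : ι → Set F) (hA : ∀ i, MeasurableSet (A i))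
    (hm : ∀ i, m (A i) ≠ ⊤) (hd : Pairwise fun i j => Disjoint (A i) (A j))
    {S : Set F} (hS : MeasurableSet S) (hmS : m S ≠ ⊤) :
    P (voidEvent Z S ∩ ⋂ i, (voidEvent Z (A i))ᶜ)
      ≤ P (voidEvent Z S) * P (⋂ i, (voidEvent Z (A i))ᶜ) := by
  -- When `S` is avoided, hitting `A i` means hitting `A i \ S`. The sets `S` and `A i \ S` are
  -- disjoint, so the corresponding events are independent.
  let C : Option ι → Set F := fun o => o.elim S fun i => A i \ S
  have hCm : ∀ o, MeasurableSet (C o) := by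
    rintro (_ | i)
    · exact hS
    · exact (hA i).diff hS
  have hCt : ∀ o, m (C o) ≠ ⊤ := by
    rintro (_ | i)
    · exact hmS
    · exact measure_ne_top_of_subset Set.sdiff_subset (hm i)
  have hCd : Pairwise fun o p => Disjoint (C o) (C p) := by
    rintro (_ | i) (_ | j) hij
    · exact absurd rfl hij
    · exact Set.disjoint_sdiff_right
    · exact Set.disjoint_sdiff_left
    · exact (hd (fun h => hij (congrArg some h))).mono Set.sdiff_subset Set.sdiff_subset
  let D : Option ι → Set Ω := fun o =>
    o.elim (voidEvent Z S) fun i => (voidEvent Z (A i \ S))ᶜ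
  have hD : P (⋂ o, D o) = ∏ o, P (D o) := by
    refine ((iIndepSet_iff_iIndep _ _).1 (hZ.iIndepSet_void C hCm hCt hCd)).meas_iInter ?_
    rintro (_ | i)
    · exact MeasurableSpace.measurableSet_generateFrom (Set.mem_singleton _)
    · exact (MeasurableSpace.measurableSet_generateFrom (Set.mem_singleton _)).compl
  have hsub : voidEvent Z S ∩ ⋂ i, (voidEvent Z (A i))ᶜ ⊆ ⋂ o, D o := by
    rintro ω ⟨h1, h2⟩
    refine Set.mem_iInter.2 ?_
    rintro (_ | i)
    · exact h1
    · intro h3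
      refine Set.mem_iInter.1 h2 i fun n hn => ?_
      exact h3 n ⟨hn, h1 n⟩
  refine (measure_mono hsub).trans ?_
  rw [hD, Fintype.prod_option, hZ.measure_iInter_compl_void A hA hm hd]
  refine mul_le_mul_right (Finset.prod_le_prod' fun i _ => measure_mono ?_) _
  exact Set.compl_subset_compl.2 (voidEvent_anti Z Set.sdiff_subset)

end HasPoissonVoids

end Void

/-! ### Independent marking -/

section Marks

variable {Ω E : Type*} [MeasurableSpace Ω] [MeasurableSpace E] {P : Measure Ω}
  [IsProbabilityMeasure P] {X : ℕ → Ω → E} {ρ : ℕ → Ω → ℝ} {ν : Measure E}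

theorem measure_marks_notMem (hρ : IsIIDPositiveMarks ρ X P) {S : Set (E × ℝ)}
    (hS : MeasurableSet S) (x : ℕ → E) (m : ℕ) :
    P {ω | ∀ i ∈ Finset.range m, (x i, ρ i ω) ∉ S}
      = ∏ i ∈ Finset.range m, (1 - P.map (ρ 0) (Prod.mk (x i) ⁻¹' S)) := by
  have hB : ∀ i, MeasurableSet (Prod.mk (x i) ⁻¹' S) := fun i => measurable_prodMk_left hS
  have := Measure.isProbabilityMeasure_map (μ := P) (hρ.measurable 0).aemeasurable
  have h1 := hρ.indep.measure_inter_preimage_eq_mul (Finset.range m)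
    (sets := fun i => (Prod.mk (x i) ⁻¹' S)ᶜ) fun i _ => (hB i).compl
  have h2 : {ω | ∀ i ∈ Finset.range m, (x i, ρ i ω) ∉ S}
      = ⋂ i ∈ Finset.range m, ρ i ⁻¹' (Prod.mk (x i) ⁻¹' S)ᶜ := by
    ext ω
    simp
  rw [h2, h1]
  refine Finset.prod_congr rfl fun i _ => ?_
  rw [(hρ.identDistrib i).measure_mem_eq (hB i).compl, ← prob_compl_eq_one_sub (hB i),
    Measure.map_apply (hρ.measurable 0) (hB i).compl]

/-- Fubini: the points are frozen first, and the marks are then integrated out. -/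
theorem measure_marked_notMem (hX : ∀ i, Measurable (X i)) (hρ : IsIIDPositiveMarks ρ X P)
    {S : Set (E × ℝ)} (hS : MeasurableSet S) (m : ℕ) :
    P {ω | ∀ i ∈ Finset.range m, (X i ω, ρ i ω) ∉ S}
      = ∫⁻ ω, ∏ i ∈ Finset.range m, (1 - P.map (ρ 0) (Prod.mk (X i ω) ⁻¹' S)) ∂P := by
  have hX' : Measurable fun ω i => X i ω := measurable_pi_lambda _ hX
  have hρ' : Measurable fun ω i => ρ i ω := measurable_pi_lambda _ hρ.measurable
  let T : Set ((ℕ → E) × (ℕ → ℝ)) := {p | ∀ i ∈ Finset.range m, (p.1 i, p.2 i) ∉ S}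
  have hT : MeasurableSet T := by
    have : T = ⋂ i ∈ Finset.range m,
        ((fun p : (ℕ → E) × (ℕ → ℝ) => (p.1 i, p.2 i)) ⁻¹' S)ᶜ := by
      ext p
      simp [T]
    rw [this]
    refine Finset.measurableSet_biInter _ fun i _ => (MeasurableSet.compl ?_)
    exact (((measurable_pi_apply i).comp measurable_fst).prodMk
      ((measurable_pi_apply i).comp measurable_snd)) hS
  have h1 := (indepFun_iff_map_prod_eq_prod_map_map hX'.aemeasurable hρ'.aemeasurable).1
    hρ.indep_points
  have h2 : P {ω | ∀ i ∈ Finset.range m, (X i ω, ρ i ω) ∉ S}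
      = P.map (fun ω => ((fun i => X i ω), (fun i => ρ i ω))) T := by
    rw [Measure.map_apply (hX'.prodMk hρ') hT]
    rfl
  have := Measure.isProbabilityMeasure_map (μ := P) hρ'.aemeasurable
  rw [h2, h1, Measure.prod_apply hT, lintegral_map (measurable_measure_prodMk_left hT) hX']
  refine lintegral_congr fun ω => ?_
  rw [Measure.map_apply hρ' (measurable_prodMk_left hT), ← measure_marks_notMem hρ hS]
  rfl

/-- Attaching i.i.d. marks to a Poisson process gives a process with Poisson avoidance
probabilities. -/
theorem IsPoissonPointProcess.hasPoissonVoids (hX : IsPoissonPointProcess X ν P)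
    (hρ : IsIIDPositiveMarks ρ X P) :
    HasPoissonVoids (fun i ω => (X i ω, ρ i ω)) (ν.prod (P.map (ρ 0))) P := by
  refine ⟨fun i => (hX.measurable i).prodMk (hρ.measurable i), fun S hS hm => ?_⟩
  have := Measure.isProbabilityMeasure_map (μ := P) (hρ.measurable 0).aemeasurable
  -- This is the probability that a mark attached at `x` puts the pair in `S`. Its integral is the
  -- intensity of `S`, and its survival product is the conditional avoidance probability given the
  -- points.
  have hg : Measurable fun x => P.map (ρ 0) (Prod.mk x ⁻¹' S) := measurable_measure_prodMk_left hS
  rw [Measure.prod_apply hS] at hm ⊢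
  rw [← hX.lintegral_survivalProduct hg (fun x => prob_le_one) hm]
  have h1 : voidEvent (fun i ω => (X i ω, ρ i ω)) S
      = ⋂ m, {ω | ∀ i ∈ Finset.range m, (X i ω, ρ i ω) ∉ S} := by
    ext ω
    simp only [voidEvent, Set.mem_ofPred_eq, Set.mem_iInter]
    exact ⟨fun h _ i _ => h i, fun h i => h (i + 1) i (Finset.self_mem_range_succ i)⟩
  rw [h1, Antitone.measure_iInter]
  · simp_rw [measure_marked_notMem hX.measurable hρ hS, survivalProduct]
    rw [lintegral_iInf]
    · exact fun m => Finset.measurable_prod _ fun i _ =>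
        measurable_const.sub (hg.comp (hX.measurable i))
    · exact fun m n hmn ω => antitone_prod_one_sub (fun i => P.map (ρ 0) (Prod.mk (X i ω) ⁻¹' S)) hmn
    · simp
  · intro m n hmn ω h i hi
    exact h i (Finset.range_mono hmn hi)
  · intro m
    refine MeasurableSet.nullMeasurableSet ?_
    have : {ω | ∀ i ∈ Finset.range m, (X i ω, ρ i ω) ∉ S}
        = ⋂ i ∈ Finset.range m, ((fun ω => (X i ω, ρ i ω)) ⁻¹' S)ᶜ := by
      ext ω
      simp
    rw [this]
    exact Finset.measurableSet_biInter _ fun i _ =>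
      (((hX.measurable i).prodMk (hρ.measurable i)) hS).compl
  · exact ⟨0, measure_ne_top _ _⟩

end Marks

/-- The second moment method: almost uncorrelated events with a large expected number of
occurrences are unlikely all to fail. -/
theorem measureReal_iInter_compl_le {Ω ι : Type*} [MeasurableSpace Ω] {P : Measure Ω}
    [IsProbabilityMeasure P] [Fintype ι] (U : ι → Set Ω) (hU : ∀ i, MeasurableSet (U i)) {ε : ℝ}
    (hε : 0 ≤ ε)
    (hcor : ∀ i j, i ≠ j → P.real (U i ∩ U j) ≤ (1 + ε) * (P.real (U i) * P.real (U j)))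
    (hpos : 0 < ∑ i, P.real (U i)) :
    P.real (⋂ i, (U i)ᶜ) ≤ 1 / (∑ i, P.real (U i)) + ε := by
  classical
  set σ := ∑ i, P.real (U i) with hσ
  have hint : ∀ i, Integrable ((U i).indicator (1 : Ω → ℝ)) P := fun i =>
    (integrable_const 1).indicator (hU i)
  have hint2 : ∀ i j, Integrable ((U i ∩ U j).indicator (1 : Ω → ℝ)) P := fun i j =>
    (integrable_const 1).indicator ((hU i).inter (hU j))
  have hexp : ∀ ω, (∑ i, (U i).indicator (1 : Ω → ℝ) ω - σ) ^ 2
      = ∑ i, ∑ j, (U i ∩ U j).indicator (1 : Ω → ℝ) ω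
        - 2 * σ * ∑ i, (U i).indicator (1 : Ω → ℝ) ω + σ ^ 2 := by
    intro ω
    simp_rw [Set.inter_indicator_one, Pi.mul_apply, ← Finset.mul_sum, ← Finset.sum_mul]
    ring
  have hI1 : Integrable (fun ω => ∑ i, ∑ j, (U i ∩ U j).indicator (1 : Ω → ℝ) ω) P :=
    integrable_finsetSum _ fun i _ => integrable_finsetSum _ fun j _ => hint2 i j
  have hI2 : Integrable (fun ω => 2 * σ * ∑ i, (U i).indicator (1 : Ω → ℝ) ω) P :=
    (integrable_finsetSum _ fun i _ => hint i).const_mul _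
  have hI : Integrable (fun ω => (∑ i, (U i).indicator (1 : Ω → ℝ) ω - σ) ^ 2) P := by
    simp_rw [hexp]
    exact (hI1.sub hI2).add (integrable_const _)
  have hval : ∫ ω, (∑ i, (U i).indicator (1 : Ω → ℝ) ω - σ) ^ 2 ∂P
      = ∑ i, ∑ j, P.real (U i ∩ U j) - σ ^ 2 := by
    have h1 := integral_add (hI1.sub hI2) (integrable_const (μ := P) (σ ^ 2))
    simp only [Pi.sub_apply] at h1
    simp_rw [hexp]
    rw [h1, integral_sub hI1 hI2, integral_const_mul, integral_finsetSum _ (fun i _ => hint i), integral_finsetSum _ (fun i _ =>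
        integrable_finsetSum _ fun j _ => hint2 i j)]
    simp_rw [integral_finsetSum _ (fun j _ => hint2 _ j),
      integral_indicator_one ((hU _).inter (hU _)), integral_indicator_one (hU _), ← hσ]
    simp
    ring
  -- The diagonal terms contribute `σ`; the others are controlled by `hcor`.
  have hsum : ∑ i, ∑ j, P.real (U i ∩ U j) ≤ σ + (1 + ε) * σ ^ 2 := by
    have h1 : ∀ i j, P.real (U i ∩ U j)
        ≤ (if i = j then P.real (U i) else 0) + (1 + ε) * (P.real (U i) * P.real (U j)) := by
      intro i j
      by_cases hij : i = j
      · subst hij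
        simp only [Set.inter_self, if_true]
        have : 0 ≤ (1 + ε) * (P.real (U i) * P.real (U i)) := by positivity
        linarith
      · rw [if_neg hij, zero_add]
        exact hcor i j hij
    refine (Finset.sum_le_sum fun i _ => Finset.sum_le_sum fun j _ => h1 i j).trans (le_of_eq ?_)
    simp_rw [Finset.sum_add_distrib, ← Finset.mul_sum, ← Finset.sum_mul, ← hσ]
    simp only [Finset.sum_ite_eq, Finset.mem_univ, if_true, ← hσ]
    ring
  -- Chebyshev: where no event occurs the squared deviation equals `σ ^ 2`.
  have hmain : σ ^ 2 * P.real (⋂ i, (U i)ᶜ) ≤ σ + ε * σ ^ 2 := by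
    have hm : MeasurableSet (⋂ i, (U i)ᶜ) := MeasurableSet.iInter fun i => (hU i).compl
    have h1 : ∫ ω, (⋂ i, (U i)ᶜ).indicator (fun _ => σ ^ 2) ω ∂P
        ≤ ∫ ω, (∑ i, (U i).indicator (1 : Ω → ℝ) ω - σ) ^ 2 ∂P := by
      refine integral_mono ((integrable_const _).indicator hm) hI fun ω => ?_
      by_cases hω : ω ∈ ⋂ i, (U i)ᶜ
      · have h2 : ∑ i, (U i).indicator (1 : Ω → ℝ) ω = 0 := Finset.sum_eq_zero fun i _ =>
          Set.indicator_of_notMem (Set.mem_iInter.1 hω i) _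
        simp [Set.indicator_of_mem hω, h2]
      · rw [Set.indicator_of_notMem hω]
        positivity
    rw [integral_indicator_const _ hm, smul_eq_mul, hval] at h1
    linarith
  rw [div_add' _ _ _ hpos.ne', le_div_iff₀ hpos]
  refine le_of_mul_le_mul_left ?_ hpos
  nlinarith

/-! ### Lattice points and volumes of balls -/

section Lattice

variable {d : ℕ}

/-- The point of `EuclideanSpace ℝ (Fin d)` with the integer coordinates `k`. -/
noncomputable def latticePoint (k : Fin d → ℤ) : EuclideanSpace ℝ (Fin d) :=
  WithLp.toLp 2 fun i => (k i : ℝ)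

theorem euclidean_norm_le_of_coord_le {x : EuclideanSpace ℝ (Fin d)} {M : ℝ} (hM : 0 ≤ M)
    (hx : ∀ i, |x i| ≤ M) : ‖x‖ ≤ d * M := by
  rw [EuclideanSpace.norm_eq]
  refine Real.sqrt_le_iff.2 ⟨by positivity, ?_⟩
  have h1 : ∑ i, ‖x i‖ ^ 2 ≤ ∑ _i : Fin d, M ^ 2 := Finset.sum_le_sum fun i _ => by
    rw [Real.norm_eq_abs]
    exact pow_le_pow_left₀ (abs_nonneg _) (hx i) 2
  have h2 : (d : ℝ) ≤ (d : ℝ) ^ 2 := by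
    exact_mod_cast Nat.le_self_pow (two_ne_zero) d
  simp only [Finset.sum_const, Finset.card_univ, Fintype.card_fin, nsmul_eq_mul] at h1
  calc _ ≤ (d : ℝ) * M ^ 2 := h1
    _ ≤ (d : ℝ) ^ 2 * M ^ 2 := by gcongr
    _ = _ := by ring

theorem exists_norm_sub_latticePoint_le (y : EuclideanSpace ℝ (Fin d)) :
    ∃ k, ‖y - latticePoint k‖ ≤ d := by
  refine ⟨fun i => round (y i), ?_⟩
  have := euclidean_norm_le_of_coord_le (x := y - latticePoint fun i => round (y i)) zero_le_one
    (fun i => (abs_sub_round (y i)).trans (by norm_num))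
  simpa using this

theorem norm_latticePoint_le {k : Fin d → ℤ} {M : ℝ} (hM : 0 ≤ M) (hk : ∀ i, |(k i : ℝ)| ≤ M) :
    ‖latticePoint k‖ ≤ d * M :=
  euclidean_norm_le_of_coord_le hM hk

theorem one_le_norm_latticePoint_sub {k l : Fin d → ℤ} (hkl : k ≠ l) :
    1 ≤ ‖latticePoint k - latticePoint l‖ := by
  obtain ⟨i, hi⟩ := Function.ne_iff.1 hkl
  have h1 : |(k i : ℝ) - l i| ≤ ‖latticePoint k - latticePoint l‖ :=
    PiLp.norm_apply_le (latticePoint k - latticePoint l) i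
  refine le_trans ?_ h1
  have := Int.one_le_abs (sub_ne_zero.2 hi)
  exact_mod_cast this

theorem finite_norm_latticePoint_le (R : ℝ) : {k : Fin d → ℤ | ‖latticePoint k‖ ≤ R}.Finite := by
  refine (Set.finite_Icc (fun _ : Fin d => -⌈R⌉) (fun _ => ⌈R⌉)).subset fun k hk => ?_
  have h1 : ∀ i, |(k i : ℝ)| ≤ ⌈R⌉ := fun i =>
    ((PiLp.norm_apply_le (latticePoint k) i).trans hk).trans (Int.le_ceil R)
  have h2 : ∀ i, |k i| ≤ ⌈R⌉ := fun i => by exact_mod_cast h1 i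
  exact ⟨fun i => (abs_le.1 (h2 i)).1, fun i => (abs_le.1 (h2 i)).2⟩

theorem tendsto_norm_latticePoint :
    Tendsto (fun k : Fin d → ℤ => ‖latticePoint k‖) cofinite atTop := by
  refine tendsto_atTop.2 fun R => ?_
  refine (finite_norm_latticePoint_le (d := d) R).subset fun k hk => ?_
  simp only [Set.mem_compl_iff, Set.mem_ofPred_eq, not_le] at hk
  exact hk.le

theorem summable_norm_rpow_span_basis {E : Type*} [NormedAddCommGroup E] [NormedSpace ℝ E]
    [FiniteDimensional ℝ E] (b : Module.Basis (Fin d) ℝ E) {s : ℝ} (hs : (d : ℝ) < s) :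
    Summable fun z : Submodule.span ℤ (Set.range b) => ‖(z : E)‖ ^ (-s) := by
  have hrank : Module.finrank ℤ (Submodule.span ℤ (Set.range b)) = d := by
    rw [ZLattice.rank ℝ, Module.finrank_eq_card_basis b, Fintype.card_fin]
  exact ZLattice.summable_norm_rpow _ (-s) (by rw [hrank]; linarith)

theorem latticePoint_mem_span (k : Fin d → ℤ) :
    latticePoint k ∈ Submodule.span ℤ (Set.range (EuclideanSpace.basisFun (Fin d) ℝ).toBasis) := by
  have h1 : latticePoint k = ∑ i, k i • (EuclideanSpace.basisFun (Fin d) ℝ).toBasis i := by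
    ext j
    simp [latticePoint, Pi.single_apply]
  rw [h1]
  exact Submodule.sum_mem _ fun i _ =>
    Submodule.smul_mem _ _ (Submodule.subset_span (Set.mem_range_self i))

theorem latticePoint_injective : Function.Injective (latticePoint (d := d)) := by
  intro k l hkl
  by_contra hne
  have h3 := one_le_norm_latticePoint_sub hne
  rw [hkl, sub_self, norm_zero] at h3
  linarith

theorem Summable.comp_injective_mem {α κ : Type*} {S : Set α} {f : α → ℝ}
    (hf : Summable fun z : S => f z) {g : κ → α} (hg : Function.Injective g) (hS : ∀ k, g k ∈ S) :
    Summable fun k => f (g k) :=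
  hf.comp_injective (show Function.Injective fun k => (⟨g k, hS k⟩ : S) from
    fun _ _ hkl => hg (congrArg Subtype.val hkl))

theorem summable_norm_latticePoint {s : ℝ} (hs : (d : ℝ) < s) :
    Summable fun k : Fin d → ℤ => ‖latticePoint k‖ ^ (-s) :=
  Summable.comp_injective_mem (f := fun x : EuclideanSpace ℝ (Fin d) => ‖x‖ ^ (-s))
    (summable_norm_rpow_span_basis (EuclideanSpace.basisFun (Fin d) ℝ).toBasis hs)
    latticePoint_injective latticePoint_mem_span

theorem volume_ball_eq_ofReal_unitBallVolume :
    volume (Metric.ball (0 : EuclideanSpace ℝ (Fin d)) 1) = ENNReal.ofReal (unitBallVolume d) :=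
  (ENNReal.ofReal_toReal measure_ball_lt_top.ne).symm

theorem unitBallVolume_pos : 0 < unitBallVolume d :=
  ENNReal.toReal_pos (Metric.measure_ball_pos _ _ one_pos).ne' measure_ball_lt_top.ne

theorem volume_norm_sub_pow_le (hd : 1 ≤ d) (y : EuclideanSpace ℝ (Fin d)) (b : ℝ) :
    volume {x : EuclideanSpace ℝ (Fin d) | ‖x - y‖ ^ d ≤ b}
      = ENNReal.ofReal b * ENNReal.ofReal (unitBallVolume d) := by
  rcases lt_or_ge b 0 with hb | hb
  · have : {x : EuclideanSpace ℝ (Fin d) | ‖x - y‖ ^ d ≤ b} = ∅ := by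
      ext x
      simp only [Set.mem_ofPred_eq, Set.mem_empty_iff_false, iff_false, not_le]
      exact hb.trans_le (by positivity)
    rw [this, measure_empty, ENNReal.ofReal_of_nonpos hb.le, zero_mul]
  · have h1 : {x : EuclideanSpace ℝ (Fin d) | ‖x - y‖ ^ d ≤ b}
        = Metric.closedBall y (b ^ (1 / (d : ℝ))) := by
      ext x
      rw [Set.mem_ofPred_eq, Metric.mem_closedBall, dist_eq_norm, one_div,
        Real.le_rpow_inv_iff_of_pos (norm_nonneg _) hb (by positivity), Real.rpow_natCast]
    rw [h1, Measure.addHaar_closedBall _ _ (by positivity), volume_ball_eq_ofReal_unitBallVolume,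
      finrank_euclideanSpace_fin, ← Real.rpow_natCast, ← Real.rpow_mul hb,
      one_div_mul_cancel (by positivity), Real.rpow_one]

theorem volume_ball_eq_ofReal (hd : 1 ≤ d) (y : EuclideanSpace ℝ (Fin d)) (r : ℝ) :
    volume (Metric.ball y r) = ENNReal.ofReal (max r 0 ^ d) * ENNReal.ofReal (unitBallVolume d) := by
  rcases le_or_gt r 0 with hr | hr
  · rw [Metric.ball_eq_empty.2 hr, max_eq_right hr, zero_pow (by omega)]
    simp
  · rw [Measure.addHaar_ball_of_pos _ _ hr, volume_ball_eq_ofReal_unitBallVolume,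
      finrank_euclideanSpace_fin, max_eq_left hr.le]

end Lattice

/-! ### Absorbing the logarithm into a power -/

section RealInequalities

theorem log_one_add_le_rpow_div {u θ : ℝ} (hu : 0 ≤ u) (hθ : 0 < θ) (hθ1 : θ ≤ 1) :
    Real.log (1 + u) ≤ u ^ θ / θ := by
  have h1 : θ * Real.log (1 + u) ≤ (1 + u) ^ θ - 1 := by
    rw [← Real.log_rpow (by linarith)]
    exact Real.log_le_sub_one_of_pos (by positivity)
  have h2 : (1 + u) ^ θ ≤ 1 + u ^ θ := by
    simpa using Real.rpow_add_le_add_rpow zero_le_one hu hθ.le hθ1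
  rw [le_div_iff₀ hθ]
  linarith

theorem log_one_add_add_le {s t : ℝ} (hs : 0 ≤ s) (ht : 0 ≤ t) :
    Real.log (1 + (s + t)) ≤ Real.log (1 + s) + Real.log (1 + t) := by
  rw [← Real.log_mul (by linarith) (by linarith)]
  exact Real.log_le_log (by linarith) (by nlinarith [mul_nonneg hs ht])

/-- The exponent `θ = d * η / (d + η)` satisfies `(d - θ) * (d + η) / d = d`, so dividing by `u ^ θ`
and raising to the power `(d + η) / d` produces exactly the available moment. -/
theorem pow_le_rpow_of_pow_le_mul_rpow {d : ℕ} (hd : 1 ≤ d) {η B r u : ℝ} (hη : 0 < η)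
    (hB : 0 < B) (hr : 0 < r) (hu : 0 ≤ u)
    (h : u ^ d ≤ r ^ d * (B * u ^ ((d : ℝ) * η / (d + η)))) :
    u ^ d ≤ B ^ (((d : ℝ) + η) / d) * r ^ ((d : ℝ) + η) := by
  have hd0 : (0 : ℝ) < d := by exact_mod_cast hd
  rcases hu.eq_or_lt with rfl | hu
  · rw [zero_pow (by omega)]
    positivity
  have h1 : u ^ ((d : ℝ) - (d : ℝ) * η / (d + η)) ≤ B * r ^ d := by
    rw [Real.rpow_sub hu, div_le_iff₀ (by positivity), Real.rpow_natCast]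
    linarith
  have h2 := Real.rpow_le_rpow (by positivity) h1 (by positivity : 0 ≤ ((d : ℝ) + η) / d)
  rw [← Real.rpow_mul hu.le, Real.mul_rpow hB.le (by positivity), ← Real.rpow_natCast r d,
    ← Real.rpow_mul hr.le] at h2
  have h3 : ((d : ℝ) - (d : ℝ) * η / (d + η)) * ((d + η) / d) = d := by
    field_simp
    ring
  have h4 : (d : ℝ) * ((d + η) / d) = d + η := by field_simp
  rwa [h3, h4, Real.rpow_natCast] at h2

/-- Either the logarithm is at most `δ * Q`, or it dominates `Q` and the whole bracket is of order
`u ^ θ`. -/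
theorem exists_pow_le_or_pow_le_rpow {d : ℕ} (hd : 1 ≤ d) {η a δ : ℝ} (hη : 0 < η) (hη1 : η ≤ 1)
    (ha : 0 < a) (hδ : 0 < δ) :
    ∃ C : ℝ, 0 < C ∧ ∀ Q u r : ℝ, 0 ≤ u → 0 < r → u ^ d ≤ r ^ d * (Q + a * Real.log (1 + u)) →
      u ^ d ≤ r ^ d * ((1 + δ) * Q) ∨ u ^ d ≤ C * r ^ ((d : ℝ) + η) := by
  have hd0 : (0 : ℝ) < d := by exact_mod_cast hd
  set θ := (d : ℝ) * η / (d + η) with hθ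
  have hθ0 : 0 < θ := by positivity
  have hθ1 : θ ≤ 1 := by
    rw [hθ, div_le_one (by positivity)]
    nlinarith
  have hB : 0 < (1 / δ + 1) * a / θ := by positivity
  refine ⟨((1 / δ + 1) * a / θ) ^ (((d : ℝ) + η) / d), by positivity, fun Q u r hu hr h => ?_⟩
  rcases le_or_gt (a * Real.log (1 + u)) (δ * Q) with h1 | h1
  · left
    refine h.trans ?_
    gcongr
    linarith
  · right
    refine pow_le_rpow_of_pow_le_mul_rpow hd hη hB hr hu (h.trans ?_)
    gcongr
    have h2 := log_one_add_le_rpow_div hu hθ0 hθ1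
    have h3 : Q ≤ 1 / δ * (a * Real.log (1 + u)) := by
      rw [one_div, ← div_eq_inv_mul, le_div_iff₀ hδ]
      linarith
    calc Q + a * Real.log (1 + u) ≤ (1 / δ + 1) * a * Real.log (1 + u) := by linarith
      _ ≤ (1 / δ + 1) * a * (u ^ θ / θ) := by gcongr
      _ = _ := by ring

/-- When `Q` is itself of order `u ^ θ`, only the second alternative remains. -/
theorem exists_pow_le_rpow_of_le_rpow {d : ℕ} (hd : 1 ≤ d) {η a A : ℝ} (hη : 0 < η) (hη1 : η ≤ 1)
    (ha : 0 < a) (hA : 0 < A) :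
    ∃ C : ℝ, 0 < C ∧ ∀ Q u r : ℝ, 0 ≤ u → 0 < r → Q ≤ A * u ^ ((d : ℝ) * η / (d + η)) →
      u ^ d ≤ r ^ d * (Q + a * Real.log (1 + u)) → u ^ d ≤ C * r ^ ((d : ℝ) + η) := by
  have hd0 : (0 : ℝ) < d := by exact_mod_cast hd
  set θ := (d : ℝ) * η / (d + η) with hθ
  have hθ0 : 0 < θ := by positivity
  have hθ1 : θ ≤ 1 := by
    rw [hθ, div_le_one (by positivity)]
    nlinarith
  have hB : 0 < A + a / θ := by positivity
  refine ⟨(A + a / θ) ^ (((d : ℝ) + η) / d), by positivity, fun Q u r hu hr hQ h => ?_⟩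
  refine pow_le_rpow_of_pow_le_mul_rpow hd hη hB hr hu (h.trans ?_)
  gcongr
  have h2 := log_one_add_le_rpow_div hu hθ0 hθ1
  calc Q + a * Real.log (1 + u) ≤ A * u ^ θ + a * (u ^ θ / θ) := by gcongr
    _ = _ := by ring

end RealInequalities

/-! ### Moments of a mark and the marked intensity -/

section Moments

variable {Ω : Type*} [MeasurableSpace Ω] {P : Measure Ω} [IsProbabilityMeasure P] {R : Ω → ℝ}

theorem integrable_rpow_of_le (hR : Measurable R) (hpos : ∀ᵐ ω ∂P, 0 < R ω) {s t : ℝ}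
    (hs : 0 ≤ s) (hst : s ≤ t) (ht : Integrable (fun ω => R ω ^ t) P) :
    Integrable (fun ω => R ω ^ s) P := by
  refine ((integrable_const 1).add ht).mono' (hR.pow_const s).aestronglyMeasurable ?_
  filter_upwards [hpos] with ω hω
  rw [Real.norm_of_nonneg (by positivity), Pi.add_apply]
  rcases le_total (R ω) 1 with h1 | h1
  · have := Real.rpow_le_one hω.le h1 hs
    have : 0 ≤ R ω ^ t := by positivity
    linarith
  · have := Real.rpow_le_rpow_of_exponent_le h1 hst
    linarith

theorem integral_pow_pos (hpos : ∀ᵐ ω ∂P, 0 < R ω) {d : ℕ}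
    (hint : Integrable (fun ω => R ω ^ d) P) : 0 < ∫ ω, R ω ^ d ∂P := by
  rw [integral_pos_iff_support_of_nonneg_ae (hpos.mono fun ω h => (by positivity)) hint]
  have h1 : P (Function.support fun ω => R ω ^ d) = P Set.univ := by
    refine measure_congr ?_
    filter_upwards [hpos] with ω hω
    exact propext ⟨fun _ => trivial, fun _ => (pow_pos hω d).ne'⟩
  rw [h1, measure_univ]
  exact one_pos

/-- The intensity measure of a Poisson process of rate `lam` with marks distributed like `R`. -/
noncomputable abbrev markedIntensity (d : ℕ) (lam : ℝ) (R : Ω → ℝ) (P : Measure Ω) :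
    Measure (EuclideanSpace ℝ (Fin d) × ℝ) :=
  (ENNReal.ofReal lam • (volume : Measure (EuclideanSpace ℝ (Fin d)))).prod (P.map R)

/-- The intensity of the marked process, as an expectation over one mark. -/
theorem marked_intensity_apply {d : ℕ} (hR : Measurable R) (lam : ℝ)
    {S : Set (EuclideanSpace ℝ (Fin d) × ℝ)} (hS : MeasurableSet S) :
    markedIntensity d lam R P S
      = ∫⁻ ω, ENNReal.ofReal lam * volume {x | (x, R ω) ∈ S} ∂P := by
  have := Measure.isProbabilityMeasure_map (μ := P) hR.aemeasurable
  rw [Measure.prod_apply_symm hS, lintegral_map (measurable_measure_prodMk_right hS) hR]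
  rfl

/-- An upper bound for the marked intensity of a set whose sections have small volume. -/
theorem marked_intensity_le {d : ℕ} (hR : Measurable R) {lam : ℝ} (hlam : 0 < lam)
    {S : Set (EuclideanSpace ℝ (Fin d) × ℝ)} (hS : MeasurableSet S) {v : Ω → ℝ}
    (hv : Integrable v P) (hv0 : ∀ᵐ ω ∂P, 0 ≤ v ω)
    (hvol : ∀ᵐ ω ∂P, volume {x | (x, R ω) ∈ S}
      ≤ ENNReal.ofReal (v ω) * ENNReal.ofReal (unitBallVolume d)) :
    markedIntensity d lam R P S
      ≤ ENNReal.ofReal (lam * unitBallVolume d * ∫ ω, v ω ∂P) := by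
  have hπ : 0 < unitBallVolume d := unitBallVolume_pos
  rw [marked_intensity_apply hR lam hS, ← integral_const_mul,
    ofReal_integral_eq_lintegral_ofReal (hv.const_mul _)
      (hv0.mono fun ω h => (mul_nonneg (by positivity) h))]
  refine lintegral_mono_ae ?_
  filter_upwards [hvol, hv0] with ω h1 h2
  rw [mul_assoc, ENNReal.ofReal_mul hlam.le, mul_comm (unitBallVolume d), ENNReal.ofReal_mul h2]
  gcongr

end Moments

/-! ### Intensity of the sets covering a given point -/

section Uncovered

variable {d : ℕ}

/-- The marked points `(x, r)` for which the ball of centre `x` and radius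
`r * (K + a * log (1 + ‖x‖)) ^ (1 / d)` contains `y`. -/
def logCoverSet (K a : ℝ) (y : EuclideanSpace ℝ (Fin d)) : Set (EuclideanSpace ℝ (Fin d) × ℝ) :=
  {p | 0 < p.2 ∧ ‖p.1 - y‖ ^ d ≤ p.2 ^ d * (K + a * Real.log (1 + ‖p.1‖))}

/-- The marked points `(x, r)` at distance at least `s` of `y` for which the ball of centre `x` and
radius `(C * r ^ t) ^ (1 / d)` contains `y`. -/
def farCoverSet (C t s : ℝ) (y : EuclideanSpace ℝ (Fin d)) : Set (EuclideanSpace ℝ (Fin d) × ℝ) :=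
  {p | 0 < p.2 ∧ s ≤ ‖p.1 - y‖ ∧ ‖p.1 - y‖ ^ d ≤ C * p.2 ^ t}

theorem measurableSet_logCoverSet (K a : ℝ) (y : EuclideanSpace ℝ (Fin d)) :
    MeasurableSet (logCoverSet K a y) := by
  have h1 : Measurable fun p : EuclideanSpace ℝ (Fin d) × ℝ => ‖p.1 - y‖ ^ d := by fun_prop
  have h2 : Measurable fun p : EuclideanSpace ℝ (Fin d) × ℝ =>
      p.2 ^ d * (K + a * Real.log (1 + ‖p.1‖)) := by fun_prop
  exact (measurableSet_lt measurable_const measurable_snd).inter (measurableSet_le h1 h2)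

theorem measurableSet_farCoverSet (C t s : ℝ) (y : EuclideanSpace ℝ (Fin d)) :
    MeasurableSet (farCoverSet C t s y) := by
  have h0 : Measurable fun p : EuclideanSpace ℝ (Fin d) × ℝ => ‖p.1 - y‖ := by fun_prop
  have h1 : Measurable fun p : EuclideanSpace ℝ (Fin d) × ℝ => ‖p.1 - y‖ ^ d := by fun_prop
  have h2 : Measurable fun p : EuclideanSpace ℝ (Fin d) × ℝ => C * p.2 ^ t := by fun_prop
  exact (measurableSet_lt measurable_const measurable_snd).inter
    ((measurableSet_le measurable_const h0).inter (measurableSet_le h1 h2))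

theorem pow_le_of_mem_logCoverSet {K a B : ℝ} (ha : 0 < a) {y : EuclideanSpace ℝ (Fin d)}
    (hy : ‖y‖ ≤ B) {p : EuclideanSpace ℝ (Fin d) × ℝ} (hp : p ∈ logCoverSet K a y) :
    ‖p.1 - y‖ ^ d ≤ p.2 ^ d * (K + a * Real.log (1 + B) + a * Real.log (1 + ‖p.1 - y‖)) := by
  refine hp.2.trans ?_
  have hp0 := hp.1
  have h1 : ‖p.1‖ ≤ B + ‖p.1 - y‖ := by
    have := norm_add_le y (p.1 - y)
    rw [add_sub_cancel] at this
    linarith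
  have h2 : Real.log (1 + ‖p.1‖) ≤ Real.log (1 + B) + Real.log (1 + ‖p.1 - y‖) :=
    (Real.log_le_log (by positivity) (by linarith)).trans
      (log_one_add_add_le ((norm_nonneg y).trans hy) (norm_nonneg _))
  refine mul_le_mul_of_nonneg_left ?_ (by positivity)
  nlinarith

variable {Ω : Type*} [MeasurableSpace Ω] {P : Measure Ω} [IsProbabilityMeasure P] {R : Ω → ℝ}

/-- The constant `C` comes from exceptionally large radii and does not depend on `K`, `B` or `y`, so
the growth in `B` has the sharp coefficient up to `1 + δ`. -/
theorem intensity_logCoverSet_le (hd : 1 ≤ d) (hR : Measurable R) (hpos : ∀ᵐ ω ∂P, 0 < R ω)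
    {η : ℝ} (hη : 0 < η) (hη1 : η ≤ 1) (hmom : Integrable (fun ω => R ω ^ ((d : ℝ) + η)) P)
    (hmom' : Integrable (fun ω => R ω ^ d) P) {lam : ℝ} (hlam : 0 < lam) {a δ : ℝ}
    (ha : 0 < a) (hδ : 0 < δ) :
    ∃ C : ℝ, 0 ≤ C ∧ ∀ K B : ℝ, 0 ≤ K → ∀ y : EuclideanSpace ℝ (Fin d), ‖y‖ ≤ B →
      markedIntensity d lam R P
        (logCoverSet K a y) ≤ ENNReal.ofReal (lam * unitBallVolume d *
          ((1 + δ) * (K + a * Real.log (1 + B)) * (∫ ω, R ω ^ d ∂P) + C)) := by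
  obtain ⟨C, hC, hC'⟩ := exists_pow_le_or_pow_le_rpow hd hη hη1 ha hδ
  refine ⟨C * ∫ ω, R ω ^ ((d : ℝ) + η) ∂P, mul_nonneg hC.le (integral_nonneg_of_ae
    (hpos.mono fun ω h => Real.rpow_nonneg h.le _)), fun K B hK y hy => ?_⟩
  have hB : 0 ≤ B := (norm_nonneg y).trans hy
  have hlog : 0 ≤ Real.log (1 + B) := Real.log_nonneg (by linarith)
  set Q := K + a * Real.log (1 + B) with hQ
  have hQ0 : 0 ≤ Q := by positivity
  have hv1 : Integrable (fun ω => (1 + δ) * Q * R ω ^ d) P := hmom'.const_mul ((1 + δ) * Q)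
  have hv2 : Integrable (fun ω => C * R ω ^ ((d : ℝ) + η)) P := hmom.const_mul C
  have h1 : (1 + δ) * Q * (∫ ω, R ω ^ d ∂P) + C * ∫ ω, R ω ^ ((d : ℝ) + η) ∂P
      = ∫ ω, ((1 + δ) * Q * R ω ^ d + C * R ω ^ ((d : ℝ) + η)) ∂P := by
    rw [integral_add hv1 hv2, integral_const_mul, integral_const_mul]
  rw [h1]
  have hv : Integrable (fun ω => (1 + δ) * Q * R ω ^ d + C * R ω ^ ((d : ℝ) + η)) P := hv1.add hv2
  refine marked_intensity_le hR hlam (measurableSet_logCoverSet K a y) hv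
    (hpos.mono fun ω h => by positivity) ?_
  filter_upwards [hpos] with ω hω
  have hsub : {x | (x, R ω) ∈ logCoverSet K a y}
      ⊆ {x | ‖x - y‖ ^ d ≤ (1 + δ) * Q * R ω ^ d} ∪
        {x | ‖x - y‖ ^ d ≤ C * R ω ^ ((d : ℝ) + η)} := by
    intro x hx
    have hx1 : (x, R ω) ∈ logCoverSet K a y := hx
    have hx2 := pow_le_of_mem_logCoverSet ha hy hx1
    rcases hC' Q ‖x - y‖ (R ω) (norm_nonneg _) hω hx2 with h | h
    · left
      rw [Set.mem_ofPred_eq]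
      linarith
    · exact Or.inr h
  refine ((measure_mono hsub).trans (measure_union_le _ _)).trans (le_of_eq ?_)
  rw [volume_norm_sub_pow_le hd, volume_norm_sub_pow_le hd, ← add_mul,
    ENNReal.ofReal_add (by positivity) (by positivity)]

theorem intensity_farCoverSet_ne_top (hd : 1 ≤ d) (hR : Measurable R)
    (hpos : ∀ᵐ ω ∂P, 0 < R ω) {t : ℝ} (hmom : Integrable (fun ω => R ω ^ t) P) {lam : ℝ}
    (hlam : 0 < lam) {C : ℝ} (hC : 0 < C) (s : ℝ) (y : EuclideanSpace ℝ (Fin d)) :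
    markedIntensity d lam R P
        (farCoverSet C t s y) ≠ ⊤ := by
  refine ((marked_intensity_le hR hlam (measurableSet_farCoverSet C t s y) (hmom.const_mul C)
    (hpos.mono fun ω h => by positivity) (ae_of_all _ fun ω => ?_)).trans_lt
      ENNReal.ofReal_lt_top).ne
  rw [← volume_norm_sub_pow_le hd y]
  exact measure_mono fun x hx => hx.2.2

/-- Translation invariance of Lebesgue measure. -/
theorem intensity_farCoverSet_eq (hR : Measurable R) (lam C t s : ℝ)
    (y : EuclideanSpace ℝ (Fin d)) :
    markedIntensity d lam R P
        (farCoverSet C t s y) =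
      markedIntensity d lam R P
        (farCoverSet C t s 0) := by
  rw [marked_intensity_apply hR lam (measurableSet_farCoverSet C t s y),
    marked_intensity_apply hR lam (measurableSet_farCoverSet C t s 0)]
  refine lintegral_congr fun ω => congrArg _ ?_
  rw [← measure_preimage_add_right volume (-y) {x | (x, R ω) ∈ farCoverSet C t s 0}]
  congr 1
  ext x
  simp [farCoverSet, sub_eq_add_neg]

/-- The sets decrease to the empty set, and the moment of order `t` makes their intensity finite. -/
theorem tendsto_intensity_farCoverSet (hd : 1 ≤ d) (hR : Measurable R)
    (hpos : ∀ᵐ ω ∂P, 0 < R ω) {t : ℝ} (hmom : Integrable (fun ω => R ω ^ t) P) {lam : ℝ}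
    (hlam : 0 < lam) {C : ℝ} (hC : 0 < C) :
    Tendsto (fun n : ℕ =>
      (markedIntensity d lam R P).real
        (farCoverSet C t ((n : ℝ) / 2) (0 : EuclideanSpace ℝ (Fin d)))) atTop (𝓝 0) := by
  have hanti : Antitone fun n : ℕ =>
      farCoverSet C t ((n : ℝ) / 2) (0 : EuclideanSpace ℝ (Fin d)) := by
    intro n k hnk p hp
    refine ⟨hp.1, le_trans ?_ hp.2.1, hp.2.2⟩
    gcongr
  have h1 := tendsto_measure_iInter_atTop
    (μ := markedIntensity d lam R P)
    (fun n : ℕ => (measurableSet_farCoverSet C t ((n : ℝ) / 2)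
      (0 : EuclideanSpace ℝ (Fin d))).nullMeasurableSet) hanti
    ⟨0, intensity_farCoverSet_ne_top hd hR hpos hmom hlam hC _ _⟩
  have h2 : ⋂ n : ℕ, farCoverSet C t ((n : ℝ) / 2) (0 : EuclideanSpace ℝ (Fin d)) = ∅ := by
    ext p
    simp only [Set.mem_iInter, Set.mem_empty_iff_false, iff_false, not_forall]
    obtain ⟨n, hn⟩ := exists_nat_gt (2 * ‖p.1 - 0‖)
    refine ⟨n, fun hp => ?_⟩
    have := hp.2.1
    linarith
  rw [h2, measure_empty] at h1
  exact (ENNReal.tendsto_toReal ENNReal.zero_ne_top).comp h1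

/-- A centre is at distance at least `s` from one of `y` and `z`. At that distance the logarithmic
terms are negligible against a power, so the radius must be exceptional. -/
theorem logCoverSet_inter_subset (hd : 1 ≤ d) {η a A : ℝ} (hη : 0 < η) (hη1 : η ≤ 1)
    (ha : 0 < a) (hA : 0 < A) :
    ∃ C : ℝ, 0 < C ∧ ∀ K B s : ℝ, ∀ y z : EuclideanSpace ℝ (Fin d), ‖y‖ ≤ B → ‖z‖ ≤ B → 0 ≤ s →
      2 * s ≤ ‖y - z‖ → K + a * Real.log (1 + B) ≤ A * s ^ ((d : ℝ) * η / (d + η)) →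
      logCoverSet K a y ∩ logCoverSet K a z
        ⊆ farCoverSet C ((d : ℝ) + η) s y ∪ farCoverSet C ((d : ℝ) + η) s z := by
  obtain ⟨C, hC, hC'⟩ := exists_pow_le_rpow_of_le_rpow hd hη hη1 ha hA
  refine ⟨C, hC, fun K B s y z hy hz hs hyz hQ p hp => ?_⟩
  have key : ∀ w : EuclideanSpace ℝ (Fin d), ‖w‖ ≤ B → s ≤ ‖p.1 - w‖ → p ∈ logCoverSet K a w →
      p ∈ farCoverSet C ((d : ℝ) + η) s w := by
    intro w hw hsw hpw
    refine ⟨hpw.1, hsw, hC' _ _ _ (norm_nonneg _) hpw.1 (hQ.trans ?_)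
      (pow_le_of_mem_logCoverSet ha hw hpw)⟩
    gcongr
  rcases le_or_gt s ‖p.1 - y‖ with h1 | h1
  · exact Or.inl (key y hy h1 hp.1)
  · refine Or.inr (key z hz ?_ hp.2)
    have h2 : ‖y - z‖ ≤ ‖p.1 - z‖ + ‖p.1 - y‖ := by
      have := norm_sub_le (p.1 - z) (p.1 - y)
      rwa [sub_sub_sub_cancel_left] at this
    linarith

end Uncovered

/-! ### The grid for the second moment method -/

section Grid

variable {d : ℕ}

/-- The `(n ^ q) ^ d` points of a cubic grid of mesh `n`. -/
noncomputable def gridPoint (n q : ℕ) (f : Fin d → Fin (n ^ q)) : EuclideanSpace ℝ (Fin d) :=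
  latticePoint fun i => ((n * (f i : ℕ) : ℕ) : ℤ)

theorem norm_gridPoint_le (n q : ℕ) (f : Fin d → Fin (n ^ q)) :
    ‖gridPoint n q f‖ ≤ d * (n : ℝ) ^ (q + 1) := by
  refine norm_latticePoint_le (by positivity) fun i => ?_
  have h1 : n * (f i : ℕ) ≤ n ^ (q + 1) := by
    rw [pow_succ']
    exact Nat.mul_le_mul_left n (f i).2.le
  rw [abs_of_nonneg (by positivity)]
  exact_mod_cast h1

theorem le_norm_gridPoint_sub {n q : ℕ} {f g : Fin d → Fin (n ^ q)} (hfg : f ≠ g) :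
    (n : ℝ) ≤ ‖gridPoint n q f - gridPoint n q g‖ := by
  have h1 : ∀ f : Fin d → Fin (n ^ q),
      gridPoint n q f = (n : ℝ) • latticePoint fun i => ((f i : ℕ) : ℤ) := by
    intro f
    ext i
    simp [gridPoint, latticePoint]
  have h2 : (fun i => ((f i : ℕ) : ℤ)) ≠ fun i => ((g i : ℕ) : ℤ) := by
    intro h
    refine hfg (funext fun i => Fin.ext ?_)
    exact_mod_cast congrFun h i
  rw [h1, h1, ← smul_sub, norm_smul, Real.norm_of_nonneg (by positivity)]
  exact le_mul_of_one_le_right (by positivity) (one_le_norm_latticePoint_sub h2)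

theorem log_one_add_mul_pow_le (hd : 1 ≤ d) {n : ℕ} (hn : 1 ≤ n) (q : ℕ) :
    Real.log (1 + d * (n : ℝ) ^ (q + 1)) ≤ Real.log (2 * d) + (q + 1) * Real.log n := by
  have hd' : (1 : ℝ) ≤ d := by exact_mod_cast hd
  have hn' : (1 : ℝ) ≤ n := by exact_mod_cast hn
  have h1 : (1 : ℝ) ≤ d * (n : ℝ) ^ (q + 1) := one_le_mul_of_one_le_of_one_le hd' (one_le_pow₀ hn')
  calc Real.log (1 + d * (n : ℝ) ^ (q + 1)) ≤ Real.log (2 * d * (n : ℝ) ^ (q + 1)) :=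
        Real.log_le_log (by positivity) (by linarith)
    _ = _ := by
        rw [Real.log_mul (by positivity) (by positivity), Real.log_pow]
        push_cast
        ring

/-- Up to constants this is `n ^ (q * d)` points times `n ^ (-β * (q + 1))`. -/
theorem tendsto_pow_mul_exp_neg_log (hd : 1 ≤ d) {α β : ℝ} {q : ℕ} (hβ : 0 ≤ β)
    (hq : β * (q + 1) < q * d) :
    Tendsto (fun n : ℕ => (((n : ℝ) ^ q) ^ d) *
      Real.exp (-(α + β * Real.log (1 + d * (n : ℝ) ^ (q + 1))))) atTop atTop := by
  have h1 : Tendsto (fun n : ℕ => Real.exp ((q * d - β * (q + 1)) * Real.log n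
      + (-(α + β * Real.log (2 * d))))) atTop atTop := by
    refine Real.tendsto_exp_atTop.comp (tendsto_atTop_add_const_right _ _ ?_)
    exact (Real.tendsto_log_atTop.comp tendsto_natCast_atTop_atTop).const_mul_atTop (by linarith)
  refine tendsto_atTop_mono' _ ?_ h1
  filter_upwards [eventually_ge_atTop 1] with n hn
  have hn' : (0 : ℝ) < n := by exact_mod_cast hn
  have h2 : ((n : ℝ) ^ q) ^ d = Real.exp (q * d * Real.log n) := by
    rw [← pow_mul, mul_comm _ (Real.log n), Real.exp_mul, Real.exp_log hn', ← Nat.cast_mul,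
      Real.rpow_natCast]
  rw [h2, ← Real.exp_add, Real.exp_le_exp]
  have := mul_le_mul_of_nonneg_left (log_one_add_mul_pow_le hd hn q) hβ
  linarith

theorem exists_log_le_mul_rpow {K a θ : ℝ} (hK : 0 ≤ K) (ha : 0 < a) (hθ : 0 < θ) (hθ1 : θ ≤ 1)
    (hd : 1 ≤ d) (q : ℕ) :
    ∃ A : ℝ, 0 < A ∧ ∀ n : ℕ, 1 ≤ n →
      K + a * Real.log (1 + d * (n : ℝ) ^ (q + 1)) ≤ A * ((n : ℝ) / 2) ^ θ := by
  have hd0 : (0 : ℝ) < d := by exact_mod_cast hd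
  -- Chosen so that `(n ^ (q + 1)) ^ τ = n ^ θ`.
  set τ := θ / (q + 1) with hτ
  have hτ0 : 0 < τ := by positivity
  have hτ1 : τ ≤ 1 := by
    rw [hτ, div_le_one (by positivity)]
    have : (0 : ℝ) ≤ q := by positivity
    linarith
  refine ⟨(K + a * ((d : ℝ) ^ τ / τ)) * 2 ^ θ, by positivity, fun n hn => ?_⟩
  have hn' : (1 : ℝ) ≤ n := by exact_mod_cast hn
  have h1 := log_one_add_le_rpow_div (u := d * (n : ℝ) ^ (q + 1)) (by positivity) hτ0 hτ1
  have h2 : ((n : ℝ) ^ (q + 1)) ^ τ = (n : ℝ) ^ θ := by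
    rw [← Real.rpow_natCast, ← Real.rpow_mul (by positivity)]
    congr 1
    rw [hτ]
    push_cast
    field_simp
  rw [Real.mul_rpow (by positivity) (by positivity), h2] at h1
  have h3 : 1 ≤ (n : ℝ) ^ θ := Real.one_le_rpow hn' hθ.le
  rw [Real.div_rpow (by positivity) (by positivity), mul_assoc, mul_div_cancel₀ _ (by positivity),
    add_mul]
  refine add_le_add (le_mul_of_one_le_right hK h3) ?_
  rw [mul_assoc]
  gcongr
  rwa [div_mul_eq_mul_div]

end Grid

/-- If `h ^ d` grows like a small enough multiple of the logarithm, the space is almost surely not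
covered. -/
theorem measure_covered_eq_zero_of_log_bound {Ω : Type*} [MeasurableSpace Ω] {P : Measure Ω}
    [IsProbabilityMeasure P] {d : ℕ} (hd : 1 ≤ d) {lam : ℝ} (hlam : 0 < lam)
    {X : ℕ → Ω → EuclideanSpace ℝ (Fin d)} {ρ : ℕ → Ω → ℝ}
    (hX : IsPoissonPointProcess X (ENNReal.ofReal lam • volume) P) (hρ : IsIIDPositiveMarks ρ X P)
    {η : ℝ} (hη : 0 < η) (hη1 : η ≤ 1) (hmom : Integrable (fun ω => ρ 0 ω ^ ((d : ℝ) + η)) P)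
    (hmom' : Integrable (fun ω => ρ 0 ω ^ d) P) {h : ℝ → ℝ} {K a : ℝ} (hK : 0 ≤ K) (ha : 0 < a)
    (hbound : ∀ r, 0 ≤ r → h r ^ d ≤ K + a * Real.log (1 + r))
    (hsub : lam * unitBallVolume d * a * (∫ ω, ρ 0 ω ^ d ∂P) < d)
    {B : EuclideanSpace ℝ (Fin d) → ℝ → Set (EuclideanSpace ℝ (Fin d))}
    (hB : ∀ x r, B x r ⊆ Metric.closedBall x r) :
    P {ω | coveredRegion B h X ρ ω = Set.univ} = 0 := by
  have hd0 : (0 : ℝ) < d := by exact_mod_cast hd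
  have hρm := hρ.measurable 0
  have hρ0 := hρ.pos 0
  have hE : 0 < ∫ ω, ρ 0 ω ^ d ∂P := integral_pow_pos hρ0 hmom'
  have hπ : 0 < unitBallVolume d := unitBallVolume_pos
  set E := ∫ ω, ρ 0 ω ^ d ∂P with hEdef
  set κ := lam * unitBallVolume d * a * E with hκ
  have hκ0 : 0 < κ := by positivity
  -- The witness places `(1 + δ) * κ` midway between `κ` and `d`.
  obtain ⟨δ, hδ, hδκ⟩ : ∃ δ : ℝ, 0 < δ ∧ (1 + δ) * κ < d := by
    refine ⟨(d - κ) / (2 * κ), div_pos (by linarith) (by linarith), ?_⟩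
    have : (1 + (d - κ) / (2 * κ)) * κ = (κ + d) / 2 := by
      field_simp
      ring
    linarith
  -- Spacing the grid leaves `n ^ q` points on a side of length `n ^ (q + 1)`; the loss `q / (q +
  -- 1)` is harmless for large `q`.
  obtain ⟨q, hq⟩ : ∃ q : ℕ, (1 + δ) * κ * (q + 1) < q * d := by
    obtain ⟨q, hq⟩ := exists_nat_gt ((1 + δ) * κ / (d - (1 + δ) * κ))
    rw [div_lt_iff₀ (by linarith)] at hq
    exact ⟨q, by linarith⟩
  have hθ0 : 0 < (d : ℝ) * η / (d + η) := by positivity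
  have hθ1 : (d : ℝ) * η / (d + η) ≤ 1 := by
    rw [div_le_one (by positivity)]
    nlinarith
  obtain ⟨A, hA, hA'⟩ := exists_log_le_mul_rpow hK ha hθ0 hθ1 hd q
  obtain ⟨C₁, hC₁0, hC₁⟩ := intensity_logCoverSet_le hd hρm hρ0 hη hη1 hmom hmom' hlam ha hδ
  obtain ⟨C₂, hC₂, hC₂'⟩ := logCoverSet_inter_subset hd hη hη1 ha hA
  have hZ := hX.hasPoissonVoids hρ
  set Z : ℕ → Ω → EuclideanSpace ℝ (Fin d) × ℝ := fun i ω => (X i ω, ρ i ω) with hZdef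
  set m := markedIntensity d lam (ρ 0) P with hm
  -- `σ n` bounds the expected number of uncovered grid points from below; `2 * w n` will bound the
  -- overlaps.
  let σ : ℕ → ℝ := fun n => (((n : ℝ) ^ q) ^ d) * Real.exp (-(lam * unitBallVolume d *
    ((1 + δ) * K * E + C₁) + (1 + δ) * κ * Real.log (1 + d * (n : ℝ) ^ (q + 1))))
  let w : ℕ → ℝ := fun n => m.real (farCoverSet C₂ ((d : ℝ) + η) ((n : ℝ) / 2) 0)
  have hσ : Tendsto σ atTop atTop := tendsto_pow_mul_exp_neg_log hd (by positivity) hq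
  have hw : Tendsto w atTop (𝓝 0) :=
    tendsto_intensity_farCoverSet hd hρm hρ0 hmom hlam hC₂
  have hkey : ∀ n : ℕ, 1 ≤ n → P.real {ω | coveredRegion B h X ρ ω = Set.univ}
      ≤ 1 / σ n + (Real.exp (2 * w n) - 1) := by
    intro n hn
    let y : (Fin d → Fin (n ^ q)) → EuclideanSpace ℝ (Fin d) := gridPoint n q
    have hy : ∀ f, ‖y f‖ ≤ d * (n : ℝ) ^ (q + 1) := norm_gridPoint_le n q
    have hSm : ∀ f, MeasurableSet (logCoverSet K a (y f)) := fun f =>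
      measurableSet_logCoverSet K a (y f)
    have hSle : ∀ f, m (logCoverSet K a (y f)) ≤ ENNReal.ofReal (lam * unitBallVolume d *
        ((1 + δ) * (K + a * Real.log (1 + d * (n : ℝ) ^ (q + 1))) * E + C₁)) := fun f =>
      hC₁ K _ hK (y f) (hy f)
    have hSt : ∀ f, m (logCoverSet K a (y f)) ≠ ⊤ := fun f =>
      ((hSle f).trans_lt ENNReal.ofReal_lt_top).ne
    have hlog : 0 ≤ Real.log (1 + d * (n : ℝ) ^ (q + 1)) := by
      have : (0 : ℝ) ≤ d * (n : ℝ) ^ (q + 1) := by positivity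
      exact Real.log_nonneg (by linarith)
    have hp : ∀ f, Real.exp (-(lam * unitBallVolume d * ((1 + δ) * K * E + C₁) +
        (1 + δ) * κ * Real.log (1 + d * (n : ℝ) ^ (q + 1))))
          ≤ P.real (voidEvent Z (logCoverSet K a (y f))) := by
      intro f
      rw [hZ.measureReal_void (hSm f) (hSt f), Real.exp_le_exp, neg_le_neg_iff]
      refine (ENNReal.toReal_le_of_le_ofReal (by positivity) (hSle f)).trans (le_of_eq ?_)
      rw [hκ]
      ring
    have hσn : σ n ≤ ∑ f, P.real (voidEvent Z (logCoverSet K a (y f))) := by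
      refine le_trans (le_of_eq ?_) (Finset.sum_le_sum fun f _ => hp f)
      simp [σ]
    have hσ0 : 0 < σ n := by
      have : (0 : ℝ) < n := by exact_mod_cast hn
      positivity
    have hw0 : 0 ≤ w n := measureReal_nonneg
    have hfar : ∀ z, m.real (farCoverSet C₂ ((d : ℝ) + η) ((n : ℝ) / 2) z) = w n := fun z =>
      congrArg ENNReal.toReal (intensity_farCoverSet_eq hρm lam _ _ _ z)
    have hfart : ∀ z, m (farCoverSet C₂ ((d : ℝ) + η) ((n : ℝ) / 2) z) ≠ ⊤ := fun z =>
      intensity_farCoverSet_ne_top hd hρm hρ0 hmom hlam hC₂ _ z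
    have hover : ∀ f g, f ≠ g →
        m.real (logCoverSet K a (y f) ∩ logCoverSet K a (y g)) ≤ 2 * w n := by
      intro f g hfg
      have h1 := hC₂' K _ ((n : ℝ) / 2) (y f) (y g) (hy f) (hy g) (by positivity)
        (by linarith [le_norm_gridPoint_sub hfg]) (hA' n hn)
      refine (measureReal_mono h1 (measure_union_ne_top (hfart _) (hfart _))).trans ?_
      refine (measureReal_union_le _ _).trans (le_of_eq ?_)
      rw [hfar, hfar]
      ring
    -- If all space is covered, each grid point has a marked point in its set, almost surely. The
    -- comparison needs no measurability of the covering event.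
    have hcov : P.real {ω | coveredRegion B h X ρ ω = Set.univ}
        ≤ P.real (⋂ f, (voidEvent Z (logCoverSet K a (y f)))ᶜ) := by
      refine ENNReal.toReal_mono (measure_ne_top _ _) (measure_mono_ae ?_)
      filter_upwards [ae_all_iff.2 hρ.pos] with ω hω hc
      refine Set.mem_iInter.2 fun f hf => ?_
      have h1 : y f ∈ coveredRegion B h X ρ ω := hc.symm ▸ Set.mem_univ _
      obtain ⟨i, hi⟩ := Set.mem_iUnion.1 h1
      have h2 := hB _ _ hi
      rw [Metric.mem_closedBall, dist_comm, dist_eq_norm] at h2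
      refine hf i ⟨hω i, ?_⟩
      calc ‖X i ω - y f‖ ^ d ≤ (ρ i ω * h ‖X i ω‖) ^ d := by gcongr
        _ = ρ i ω ^ d * h ‖X i ω‖ ^ d := mul_pow _ _ _
        _ ≤ _ := mul_le_mul_of_nonneg_left (hbound _ (norm_nonneg _)) (pow_nonneg (hω i).le _)
    have h3 := measureReal_iInter_compl_le (P := P)
      (fun f => voidEvent Z (logCoverSet K a (y f))) (fun f => hZ.measurableSet_voidEvent (hSm f))
      (ε := Real.exp (2 * w n) - 1) (by linarith [Real.one_le_exp (by linarith : 0 ≤ 2 * w n)])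
      (by
        intro f g hfg
        rw [hZ.measureReal_void_inter (hSm f) (hSm g) (hSt f) (hSt g), add_sub_cancel, mul_assoc]
        exact mul_le_mul_of_nonneg_right (Real.exp_le_exp.2 (hover f g hfg)) (by positivity))
      (hσ0.trans_le hσn)
    refine hcov.trans (h3.trans ?_)
    gcongr
  have hlim : Tendsto (fun n => 1 / σ n + (Real.exp (2 * w n) - 1)) atTop (𝓝 0) := by
    have h1 : Tendsto (fun n => 1 / σ n) atTop (𝓝 0) := hσ.const_div_atTop 1
    have h2 : Tendsto (fun n => Real.exp (2 * w n) - 1) atTop (𝓝 (Real.exp (2 * 0) - 1)) :=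
      ((Real.continuous_exp.tendsto _).comp (hw.const_mul 2)).sub_const 1
    simpa using h1.add h2
  have h0 : P.real {ω | coveredRegion B h X ρ ω = Set.univ} ≤ 0 :=
    ge_of_tendsto hlim (eventually_atTop.2 ⟨1, hkey⟩)
  exact (measureReal_eq_zero_iff).1 (le_antisymm h0 measureReal_nonneg)

/-! ### Sets whose points cover a whole cell -/

section Covered

variable {d : ℕ}

/-- The marked points `(x, r)` with `r ≤ T` for which the ball of centre `x` and radius `r * T`
contains every point at distance at most `d` of `z`. -/
def nearCoverSet (T : ℝ) (z : EuclideanSpace ℝ (Fin d)) : Set (EuclideanSpace ℝ (Fin d) × ℝ) :=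
  {p | p.2 ≤ T ∧ ‖p.1 - z‖ + d < p.2 * T}

theorem measurableSet_nearCoverSet (T : ℝ) (z : EuclideanSpace ℝ (Fin d)) :
    MeasurableSet (nearCoverSet T z) := by
  have h1 : Measurable fun p : EuclideanSpace ℝ (Fin d) × ℝ => ‖p.1 - z‖ + d := by fun_prop
  have h2 : Measurable fun p : EuclideanSpace ℝ (Fin d) × ℝ => p.2 * T := by fun_prop
  exact (measurableSet_le measurable_snd measurable_const).inter (measurableSet_lt h1 h2)

/-- The `d`-th power of `r - d / T`, truncated below at `0` and cut off beyond `T`. -/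
noncomputable def truncatedPow (d : ℕ) (T r : ℝ) : ℝ :=
  if r ≤ T then max (r - d / T) 0 ^ d else 0

theorem truncatedPow_nonneg (T r : ℝ) : 0 ≤ truncatedPow d T r := by
  unfold truncatedPow
  split_ifs <;> positivity

theorem truncatedPow_le {T r : ℝ} (hT : 0 ≤ T) (hr : 0 ≤ r) : truncatedPow d T r ≤ r ^ d := by
  unfold truncatedPow
  split_ifs
  · have h1 : (0 : ℝ) ≤ d / T := by positivity
    exact pow_le_pow_left₀ (le_max_right _ _) (max_le (by linarith) hr) d
  · positivity

theorem measurable_truncatedPow (T : ℝ) : Measurable (truncatedPow d T) :=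
  Measurable.ite measurableSet_Iic (by fun_prop) measurable_const

theorem tendsto_truncatedPow {r : ℝ} (hr : 0 ≤ r) :
    Tendsto (fun T => truncatedPow d T r) atTop (𝓝 (r ^ d)) := by
  have h1 : Tendsto (fun T : ℝ => max (r - d / T) 0 ^ d) atTop (𝓝 (max (r - 0) 0 ^ d)) :=
    ((tendsto_const_nhds.sub (tendsto_id.const_div_atTop (d : ℝ))).max tendsto_const_nhds).pow d
  rw [sub_zero, max_eq_left hr] at h1
  refine h1.congr' ?_
  filter_upwards [eventually_ge_atTop r] with T hT
  rw [truncatedPow, if_pos hT]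

variable {Ω : Type*} [MeasurableSpace Ω] {P : Measure Ω} {R : Ω → ℝ}

theorem integrable_truncatedPow (hR : Measurable R) (hpos : ∀ᵐ ω ∂P, 0 < R ω)
    (hmom : Integrable (fun ω => R ω ^ d) P) {T : ℝ} (hT : 0 ≤ T) :
    Integrable (fun ω => truncatedPow d T (R ω)) P := by
  refine hmom.mono' ((measurable_truncatedPow T).comp hR).aestronglyMeasurable ?_
  filter_upwards [hpos] with ω hω
  rw [Real.norm_of_nonneg (truncatedPow_nonneg _ _)]
  exact truncatedPow_le hT hω.le

theorem tendsto_integral_truncatedPow (hR : Measurable R) (hpos : ∀ᵐ ω ∂P, 0 < R ω)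
    (hmom : Integrable (fun ω => R ω ^ d) P) :
    Tendsto (fun T => ∫ ω, truncatedPow d T (R ω) ∂P) atTop (𝓝 (∫ ω, R ω ^ d ∂P)) := by
  refine tendsto_integral_filter_of_dominated_convergence (fun ω => R ω ^ d)
    (Eventually.of_forall fun T => ((measurable_truncatedPow T).comp hR).aestronglyMeasurable)
    ?_ hmom (hpos.mono fun ω hω => tendsto_truncatedPow hω.le)
  filter_upwards [eventually_ge_atTop 0] with T hT
  filter_upwards [hpos] with ω hω
  rw [Real.norm_of_nonneg (truncatedPow_nonneg _ _)]
  exact truncatedPow_le hT hω.le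

variable [IsProbabilityMeasure P]

/-- For a mark `r ≤ T` the section is a ball of radius `r * T - d = T * (r - d / T)`. -/
theorem intensity_nearCoverSet (hd : 1 ≤ d) (hR : Measurable R) (hpos : ∀ᵐ ω ∂P, 0 < R ω)
    (hmom : Integrable (fun ω => R ω ^ d) P) {lam : ℝ} (hlam : 0 < lam) {T : ℝ} (hT : 0 < T)
    (z : EuclideanSpace ℝ (Fin d)) :
    markedIntensity d lam R P (nearCoverSet T z) = ENNReal.ofReal
      (lam * unitBallVolume d * T ^ d * ∫ ω, truncatedPow d T (R ω) ∂P) := by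
  have hπ : 0 < unitBallVolume d := unitBallVolume_pos
  rw [marked_intensity_apply hR lam (measurableSet_nearCoverSet T z), ← integral_const_mul,
    ofReal_integral_eq_lintegral_ofReal ((integrable_truncatedPow hR hpos hmom hT.le).const_mul _)
      (ae_of_all _ fun ω => mul_nonneg (by positivity) (truncatedPow_nonneg _ _))]
  refine lintegral_congr fun ω => ?_
  rw [mul_assoc, mul_assoc, ENNReal.ofReal_mul hlam.le, mul_comm (unitBallVolume d),
    ENNReal.ofReal_mul (mul_nonneg (by positivity) (truncatedPow_nonneg _ _))]
  congr 1
  rcases le_or_gt (R ω) T with h | h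
  · have h1 : {x | (x, R ω) ∈ nearCoverSet T z} = Metric.ball z (R ω * T - d) := by
      ext x
      simp only [nearCoverSet, Set.mem_ofPred_eq, h, true_and, Metric.mem_ball, dist_eq_norm]
      exact lt_sub_iff_add_lt.symm
    rw [h1, volume_ball_eq_ofReal hd, truncatedPow, if_pos h, ← mul_pow, mul_max_of_nonneg _ _ hT.le,
      mul_zero]
    congr 5
    field_simp
  · have h1 : {x | (x, R ω) ∈ nearCoverSet T z} = ∅ := by
      ext x
      simp [nearCoverSet, h]
    rw [h1, measure_empty, truncatedPow, if_neg h.not_ge]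
    simp

/-- The cutoff `r ≤ T` keeps the centre within `T ^ 2 ≤ t` of `z`, hence at norm at least `t`, where
monotonicity gives `h ‖x‖ ≥ T`. -/
theorem mem_ball_of_mem_nearCoverSet {h : ℝ → ℝ} (hmono : MonotoneOn h (Set.Ici 0)) {T t : ℝ}
    (hT : 0 < T) (ht : T ^ 2 ≤ t) (hTh : T ≤ h t) {z y x : EuclideanSpace ℝ (Fin d)} {r : ℝ}
    (hz : ‖z‖ = 2 * t) (hy : ‖y - z‖ ≤ d) (hx : (x, r) ∈ nearCoverSet T z) :
    y ∈ Metric.ball x (r * h ‖x‖) := by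
  obtain ⟨h1, h2⟩ : r ≤ T ∧ ‖x - z‖ + d < r * T := hx
  have hd0 : (0 : ℝ) ≤ d := by positivity
  have hr : 0 < r := by
    by_contra hr
    have := mul_nonpos_of_nonpos_of_nonneg (not_lt.1 hr) hT.le
    linarith [norm_nonneg (x - z)]
  have ht0 : 0 ≤ t := (sq_nonneg T).trans ht
  have h3 : t ≤ ‖x‖ := by
    have h4 : ‖z‖ ≤ ‖x‖ + ‖x - z‖ := by
      have := norm_sub_le x (x - z)
      rwa [sub_sub_cancel] at this
    have h5 : r * T ≤ T ^ 2 := by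
      rw [sq]
      gcongr
    linarith
  have h6 : T ≤ h ‖x‖ := hTh.trans (hmono ht0 (norm_nonneg x) h3)
  rw [Metric.mem_ball, dist_eq_norm]
  calc ‖y - x‖ = ‖(y - z) - (x - z)‖ := by rw [sub_sub_sub_cancel_right]
    _ ≤ ‖y - z‖ + ‖x - z‖ := norm_sub_le _ _
    _ < r * T := by linarith
    _ ≤ r * h ‖x‖ := by gcongr

theorem exists_measure_lt_pos (hpos : ∀ᵐ ω ∂P, 0 < R ω) : ∃ ε : ℝ, 0 < ε ∧ P {ω | ε < R ω} ≠ 0 := by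
  by_contra! hcon
  have h1 : P (⋃ n : ℕ, {ω | 1 / ((n : ℝ) + 1) < R ω}) = 0 :=
    measure_iUnion_null fun n => hcon _ (by positivity)
  have h2 : ∀ᵐ ω ∂P, False := by
    filter_upwards [hpos, measure_eq_zero_iff_ae_notMem.1 h1] with ω hω hn
    obtain ⟨n, hn'⟩ := exists_nat_one_div_lt hω
    exact hn (Set.mem_iUnion.2 ⟨n, hn'⟩)
  exact (NeZero.ne P) (by simpa using h2)

/-- The marked points with mark larger than `ε` near the rescaled lattice point
`δ • latticePoint j`. -/
def tileSet (δ ε : ℝ) (j : Fin d → ℤ) : Set (EuclideanSpace ℝ (Fin d) × ℝ) :=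
  Metric.ball (δ • latticePoint j) (δ / 2) ×ˢ Set.Ioi ε

theorem measurableSet_tileSet (δ ε : ℝ) (j : Fin d → ℤ) : MeasurableSet (tileSet δ ε j) :=
  measurableSet_ball.prod measurableSet_Ioi

theorem disjoint_tileSet {δ : ℝ} (hδ : 0 < δ) (ε : ℝ) {j k : Fin d → ℤ} (hjk : j ≠ k) :
    Disjoint (tileSet δ ε j) (tileSet δ ε k) := by
  refine Set.disjoint_left.2 fun p hj hk => ?_
  have h1 := dist_triangle_left (δ • latticePoint j) (δ • latticePoint k) p.1
  have h2 := Metric.mem_ball.1 hj.1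
  have h3 := Metric.mem_ball.1 hk.1
  have h4 := one_le_norm_latticePoint_sub hjk
  rw [dist_eq_norm (δ • _), ← smul_sub, norm_smul, Real.norm_of_nonneg hδ.le] at h1
  nlinarith

theorem intensity_tileSet (hR : Measurable R) {lam : ℝ} (δ ε : ℝ) (j : Fin d → ℤ) :
    markedIntensity d lam R P (tileSet δ ε j) = ENNReal.ofReal lam *
      volume (Metric.ball (δ • latticePoint j) (δ / 2)) * P {ω | ε < R ω} := by
  have := Measure.isProbabilityMeasure_map (μ := P) hR.aemeasurable
  rw [markedIntensity, tileSet, Measure.prod_prod, Measure.smul_apply, smul_eq_mul,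
    Measure.map_apply hR measurableSet_Ioi]
  rfl

/-- Since `h` is at least `h 0`, a mark above `ε` gives a radius above `ε * h 0`, enough to cover a
neighbourhood of the tile. -/
theorem mem_ball_of_mem_tileSet {h : ℝ → ℝ} (hmono : MonotoneOn h (Set.Ici 0)) {δ ε : ℝ}
    (hδ : 0 < δ) (hε : 0 < ε) (h0 : 0 < h 0) (hδε : (d + 1) * δ ≤ ε * h 0) {j : Fin d → ℤ}
    {y x : EuclideanSpace ℝ (Fin d)} {r : ℝ} (hy : ‖y - δ • latticePoint j‖ ≤ d * δ)
    (hx : (x, r) ∈ tileSet δ ε j) : y ∈ Metric.ball x (r * h ‖x‖) := by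
  have h1 : ‖x - δ • latticePoint j‖ < δ / 2 := by
    have := Metric.mem_ball.1 hx.1
    rwa [dist_eq_norm] at this
  have h2 : ε < r := hx.2
  have h3 : h 0 ≤ h ‖x‖ := hmono (Set.mem_Ici.2 le_rfl) (norm_nonneg x) (norm_nonneg x)
  rw [Metric.mem_ball, dist_eq_norm]
  calc ‖y - x‖ = ‖(y - δ • latticePoint j) - (x - δ • latticePoint j)‖ := by
        rw [sub_sub_sub_cancel_right]
    _ ≤ ‖y - δ • latticePoint j‖ + ‖x - δ • latticePoint j‖ := norm_sub_le _ _
    _ < (d + 1) * δ := by linarith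
    _ ≤ ε * h 0 := hδε
    _ ≤ r * h ‖x‖ := mul_le_mul h2.le h3 h0.le (hε.trans h2).le

theorem exists_norm_sub_smul_latticePoint_le {δ : ℝ} (hδ : 0 < δ) (y : EuclideanSpace ℝ (Fin d)) :
    ∃ j, ‖y - δ • latticePoint j‖ ≤ d * δ ∧ ‖latticePoint j‖ ≤ ‖y‖ / δ + d := by
  obtain ⟨j, hj⟩ := exists_norm_sub_latticePoint_le (δ⁻¹ • y)
  refine ⟨j, ?_, ?_⟩
  · have h1 : y - δ • latticePoint j = δ • (δ⁻¹ • y - latticePoint j) := by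
      rw [smul_sub, smul_inv_smul₀ hδ.ne']
    rw [h1, norm_smul, Real.norm_of_nonneg hδ.le, mul_comm]
    gcongr
  · have h2 := norm_sub_norm_le (latticePoint j) (δ⁻¹ • y)
    rw [norm_sub_rev, norm_smul, Real.norm_of_nonneg (by positivity), inv_mul_eq_div] at h2
    linarith

theorem intensity_tileSet_ne_top (hR : Measurable R) (lam δ ε : ℝ) (j : Fin d → ℤ) :
    markedIntensity d lam R P (tileSet δ ε j) ≠ ⊤ := by
  rw [intensity_tileSet hR]
  exact ENNReal.mul_ne_top (ENNReal.mul_ne_top ENNReal.ofReal_ne_top measure_ball_lt_top.ne)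
    (measure_ne_top _ _)

theorem intensity_tileSet_ne_zero (hR : Measurable R) {lam δ ε : ℝ} (hlam : 0 < lam) (hδ : 0 < δ)
    (hε : P {ω | ε < R ω} ≠ 0) (j : Fin d → ℤ) :
    markedIntensity d lam R P (tileSet δ ε j) ≠ 0 := by
  rw [intensity_tileSet hR]
  exact mul_ne_zero (mul_ne_zero (ENNReal.ofReal_pos.2 hlam).ne'
    (Metric.measure_ball_pos _ _ (by linarith)).ne') hε

/-- Finitely many disjoint sets of positive intensity are all hit with positive probability. -/
theorem HasPoissonVoids.measure_iInter_compl_void_ne_zero {F ι : Type*} [MeasurableSpace F]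
    [Fintype ι] {Z : ℕ → Ω → F} {m : Measure F} (hZ : HasPoissonVoids Z m P) (A : ι → Set F)
    (hA : ∀ i, MeasurableSet (A i)) (hm : ∀ i, m (A i) ≠ ⊤) (hm0 : ∀ i, m (A i) ≠ 0)
    (hd : Pairwise fun i j => Disjoint (A i) (A j)) : P (⋂ i, (voidEvent Z (A i))ᶜ) ≠ 0 := by
  rw [hZ.measure_iInter_compl_void A hA hm hd]
  refine Finset.prod_ne_zero_iff.2 fun i _ => ?_
  rw [prob_compl_eq_one_sub (hZ.measurableSet_voidEvent (hA i)), hZ.measure_void _ (hA i) (hm i)]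
  refine (tsub_pos_of_lt ?_).ne'
  rw [ENNReal.ofReal_lt_one, Real.exp_lt_one_iff, neg_lt_zero]
  exact ENNReal.toReal_pos (hm0 i) (hm i)

end Covered

/-! ### Growth of the comparison radius -/

section Asymptotics

theorem tendsto_mul_log_rpow {d : ℕ} (hd : 1 ≤ d) {a : ℝ} (ha : 0 < a) :
    Tendsto (fun t => (a * Real.log t) ^ (1 / (d : ℝ))) atTop atTop :=
  (tendsto_rpow_atTop (by positivity)).comp (Real.tendsto_log_atTop.const_mul_atTop ha)

theorem eventually_mul_log_rpow_sq_le {d : ℕ} (hd : 1 ≤ d) {a : ℝ} (ha : 0 < a) :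
    ∀ᶠ t in atTop, ((a * Real.log t) ^ (1 / (d : ℝ))) ^ 2 ≤ t := by
  have hd0 : (0 : ℝ) < d := by exact_mod_cast hd
  have h1 := (isLittleO_log_rpow_atTop (by positivity : (0 : ℝ) < d / 2)).bound
    (by positivity : 0 < 1 / a)
  filter_upwards [h1, eventually_ge_atTop 1] with t ht ht1
  have hlog := Real.log_nonneg ht1
  have ht0 : 0 ≤ t := by linarith
  rw [Real.norm_of_nonneg hlog, Real.norm_of_nonneg (by positivity), one_div,
    ← div_eq_inv_mul, le_div_iff₀ ha] at ht
  calc ((a * Real.log t) ^ (1 / (d : ℝ))) ^ 2 ≤ ((t ^ ((d : ℝ) / 2)) ^ (1 / (d : ℝ))) ^ 2 := by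
        gcongr
        linarith
    _ = t := by
        rw [← Real.rpow_natCast, ← Real.rpow_mul ht0, ← Real.rpow_mul ht0]
        have : (d : ℝ) / 2 * (1 / d) * ((2 : ℕ) : ℝ) = 1 := by
          push_cast
          field_simp
        rw [this, Real.rpow_one]

end Asymptotics

/-- If the probabilities of avoiding the sets `S k` sum to less than one, then with positive
probability all of them, and finitely many given disjoint sets, are hit. -/
theorem HasPoissonVoids.measure_pos_of_tsum_lt_one {Ω F ι κ : Type*} [MeasurableSpace Ω]
    [MeasurableSpace F] {P : Measure Ω} [IsProbabilityMeasure P] [Fintype ι] [Countable κ]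
    {Z : ℕ → Ω → F} {m : Measure F} (hZ : HasPoissonVoids Z m P) (A : ι → Set F)
    (hA : ∀ i, MeasurableSet (A i)) (hm : ∀ i, m (A i) ≠ ⊤) (hm0 : ∀ i, m (A i) ≠ 0)
    (hd : Pairwise fun i j => Disjoint (A i) (A j)) (S : κ → Set F)
    (hS : ∀ k, MeasurableSet (S k)) (hmS : ∀ k, m (S k) ≠ ⊤)
    (hsum : ∑' k, P (voidEvent Z (S k)) < 1) {G : Set Ω}
    (hG : (⋂ i, (voidEvent Z (A i))ᶜ) ∩ (⋂ k, (voidEvent Z (S k))ᶜ) ⊆ G) : 0 < P G := by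
  set I := ⋂ i, (voidEvent Z (A i))ᶜ with hI
  have hI0 : P I ≠ 0 := hZ.measure_iInter_compl_void_ne_zero A hA hm hm0 hd
  rw [pos_iff_ne_zero]
  intro hG0
  -- If `P G = 0`, then almost all of `I` lies in the failures of the `S k`, which by negative
  -- correlation fill only a fraction less than one of `I`.
  have hsub : I ⊆ G ∪ ⋃ k, voidEvent Z (S k) ∩ I := by
    intro ω hω
    by_cases h : ω ∈ ⋂ k, (voidEvent Z (S k))ᶜ
    · exact Or.inl (hG ⟨hω, h⟩)
    · simp only [Set.mem_iInter, not_forall, Set.mem_compl_iff, not_not] at h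
      obtain ⟨k, hk⟩ := h
      exact Or.inr (Set.mem_iUnion.2 ⟨k, hk, hω⟩)
  have h1 : P I ≤ (∑' k, P (voidEvent Z (S k))) * P I := by
    calc P I ≤ P G + P (⋃ k, voidEvent Z (S k) ∩ I) :=
          (measure_mono hsub).trans (measure_union_le _ _)
      _ ≤ ∑' k, P (voidEvent Z (S k) ∩ I) := by
          rw [hG0, zero_add]
          exact measure_iUnion_le _
      _ ≤ ∑' k, P (voidEvent Z (S k)) * P I := ENNReal.tsum_le_tsum fun k =>
          hZ.measure_void_inter_iInter_compl_le A hA hm hd (hS k) (hmS k)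
      _ = _ := ENNReal.tsum_mul_right
  have h2 : (∑' k, P (voidEvent Z (S k))) * P I < 1 * P I :=
    ENNReal.mul_lt_mul_left hI0 (measure_ne_top _ _) hsum
  rw [one_mul] at h2
  exact absurd h1 h2.not_ge

/-- If `h ^ d` grows at least like a large enough multiple of the logarithm, the space is covered
with positive probability. -/
theorem measure_covered_pos_of_log_bound {Ω : Type*} [MeasurableSpace Ω] {P : Measure Ω}
    [IsProbabilityMeasure P] {d : ℕ} (hd : 1 ≤ d) {lam : ℝ} (hlam : 0 < lam)
    {X : ℕ → Ω → EuclideanSpace ℝ (Fin d)} {ρ : ℕ → Ω → ℝ}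
    (hX : IsPoissonPointProcess X (ENNReal.ofReal lam • volume) P) (hρ : IsIIDPositiveMarks ρ X P)
    (hmom : Integrable (fun ω => ρ 0 ω ^ d) P) {h : ℝ → ℝ} (hmono : MonotoneOn h (Set.Ici 0))
    (hpos : ∀ r, 0 ≤ r → 0 < h r) {a : ℝ} (ha : 0 < a)
    (hbound : ∀ᶠ r in atTop, a * Real.log r ≤ h r ^ d)
    (hsup : d < lam * unitBallVolume d * a * (∫ ω, ρ 0 ω ^ d ∂P))
    {B : EuclideanSpace ℝ (Fin d) → ℝ → Set (EuclideanSpace ℝ (Fin d))}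
    (hB : ∀ x r, Metric.ball x r ⊆ B x r) :
    0 < P {ω | coveredRegion B h X ρ ω = Set.univ} := by
  have hd0 : (0 : ℝ) < d := by exact_mod_cast hd
  have hρm := hρ.measurable 0
  have hρ0 := hρ.pos 0
  have hπ : 0 < unitBallVolume d := unitBallVolume_pos
  have hZ := hX.hasPoissonVoids hρ
  set Z : ℕ → Ω → EuclideanSpace ℝ (Fin d) × ℝ := fun i ω => (X i ω, ρ i ω) with hZdef
  -- The slack below the limiting coefficient absorbs the truncation, while `d < s` keeps the
  -- lattice sum convergent.
  obtain ⟨s, hds, hsE⟩ := exists_between hsup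
  let T : ℝ → ℝ := fun t => (a * Real.log t) ^ (1 / (d : ℝ))
  have hT : Tendsto T atTop atTop := tendsto_mul_log_rpow hd ha
  let Good : ℝ → Prop := fun t => 0 < T t ∧ T t ^ 2 ≤ t ∧ T t ≤ h t ∧
    ∀ z : EuclideanSpace ℝ (Fin d),
      P (voidEvent Z (nearCoverSet (T t) z)) ≤ ENNReal.ofReal (t ^ (-s))
  have hgood : ∀ᶠ t in atTop, Good t := by
    have h1 : ∀ᶠ t in atTop, s < lam * unitBallVolume d * a *
        ∫ ω, truncatedPow d (T t) (ρ 0 ω) ∂P :=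
      (((tendsto_integral_truncatedPow hρm hρ0 hmom).comp hT).const_mul _).eventually_const_lt hsE
    filter_upwards [h1, hT.eventually_gt_atTop 0, eventually_mul_log_rpow_sq_le hd ha, hbound,
      eventually_gt_atTop 1] with t ht1 ht2 ht3 ht4 ht5
    have hlog : 0 < Real.log t := Real.log_pos ht5
    have hTd : T t ^ d = a * Real.log t := by
      rw [← Real.rpow_natCast, ← Real.rpow_mul (by positivity), one_div_mul_cancel hd0.ne',
        Real.rpow_one]
    refine ⟨ht2, ht3, ?_, fun z => ?_⟩
    · exact le_of_pow_le_pow_left₀ (by omega) (hpos t (by linarith)).le (hTd.trans_le ht4)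
    · have hm := intensity_nearCoverSet hd hρm hρ0 hmom hlam ht2 z
      rw [hZ.measure_void _ (measurableSet_nearCoverSet _ z) (by
        rw [hm]
        exact ENNReal.ofReal_ne_top), hm, ENNReal.toReal_ofReal (mul_nonneg (by positivity)
        (integral_nonneg fun ω => truncatedPow_nonneg _ _)), hTd]
      refine ENNReal.ofReal_le_ofReal ?_
      rw [Real.rpow_def_of_pos (by linarith), Real.exp_le_exp]
      nlinarith
  have hbad : {k : Fin d → ℤ | ¬ Good (‖latticePoint k‖ / 2)}.Finite := eventually_cofinite.1
    ((tendsto_norm_latticePoint.atTop_div_const two_pos).eventually hgood)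
  have hsum : Summable fun k : Fin d → ℤ => (‖latticePoint k‖ / 2) ^ (-s) := by
    simp_rw [Real.div_rpow (norm_nonneg _) zero_le_two]
    exact (summable_norm_latticePoint hds).div_const _
  -- Enlarging the finite set of bad lattice points makes the remaining tail smaller than one.
  obtain ⟨J₀, hJ₀, hJ₀'⟩ : ∃ J₀ : Finset (Fin d → ℤ),
      hbad.toFinset ⊆ J₀ ∧ ∑' k : {k // k ∉ J₀}, (‖latticePoint (k : Fin d → ℤ)‖ / 2) ^ (-s) < 1 :=
    ((eventually_ge_atTop _).and
      ((tendsto_tsum_compl_atTop_zero fun k : Fin d → ℤ =>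
        (‖latticePoint k‖ / 2) ^ (-s)).eventually_lt_const one_pos)).exists
  have hgood₀ : ∀ k, k ∉ J₀ → Good (‖latticePoint k‖ / 2) := fun k hk => by
    by_contra hk'
    exact hk (hJ₀ (hbad.mem_toFinset.2 hk'))
  obtain ⟨ε, hε, hεP⟩ := exists_measure_lt_pos hρ0
  have hh0 : 0 < h 0 := hpos 0 le_rfl
  obtain ⟨δ, hδ0, hδε⟩ : ∃ δ : ℝ, 0 < δ ∧ (d + 1) * δ ≤ ε * h 0 :=
    ⟨ε * h 0 / (d + 1), by positivity, by rw [mul_div_cancel₀ _ (by positivity)]⟩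
  -- Points within `d` of a lattice point of `J₀` have norm at most `L`; the tiles indexed by `J`
  -- serve all of them.
  obtain ⟨L, hL⟩ : ∃ L, ∀ k ∈ J₀, ‖latticePoint k‖ + d ≤ L := by
    obtain ⟨L, hL⟩ := (J₀.image fun k => ‖latticePoint k‖ + (d : ℝ)).exists_le
    exact ⟨L, fun k hk => hL _ (Finset.mem_image_of_mem _ hk)⟩
  obtain ⟨J, hJ⟩ : ∃ J : Finset (Fin d → ℤ), ∀ j, ‖latticePoint j‖ ≤ L / δ + d → j ∈ J :=
    ⟨(finite_norm_latticePoint_le (L / δ + d)).toFinset, fun j hj => by simpa using hj⟩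
  let S : {k // k ∉ J₀} → Set (EuclideanSpace ℝ (Fin d) × ℝ) := fun k =>
    nearCoverSet (T (‖latticePoint (k : Fin d → ℤ)‖ / 2)) (latticePoint (k : Fin d → ℤ))
  let A : J → Set (EuclideanSpace ℝ (Fin d) × ℝ) := fun j =>
    tileSet δ ε (j : Fin d → ℤ)
  have hAm : ∀ j, MeasurableSet (A j) := fun j =>
    measurableSet_tileSet δ ε (j : Fin d → ℤ)
  have hAt : ∀ j, markedIntensity d lam (ρ 0) P (A j) ≠ ⊤ := fun j =>
    intensity_tileSet_ne_top hρm lam δ ε (j : Fin d → ℤ)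
  have hA0 : ∀ j, markedIntensity d lam (ρ 0) P (A j) ≠ 0 := fun j =>
    intensity_tileSet_ne_zero hρm hlam hδ0 hεP (j : Fin d → ℤ)
  have hAd : Pairwise fun j k => Disjoint (A j) (A k) := fun j k hjk =>
    disjoint_tileSet hδ0 ε (Subtype.coe_injective.ne hjk)
  have hSm : ∀ k, MeasurableSet (S k) := fun k => measurableSet_nearCoverSet _ _
  have hSt : ∀ k, markedIntensity d lam (ρ 0) P (S k) ≠ ⊤ := fun k => ?_
  refine hZ.measure_pos_of_tsum_lt_one A hAm hAt hA0 hAd S hSm hSt ?_ ?_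
  rotate_left 2
  · refine ne_of_eq_of_ne (intensity_nearCoverSet hd hρm hρ0 hmom hlam ?_ _) ENNReal.ofReal_ne_top
    exact (hgood₀ k k.2).1
  · calc ∑' k, P (voidEvent Z (S k))
        ≤ ∑' k : {k // k ∉ J₀}, ENNReal.ofReal ((‖latticePoint (k : Fin d → ℤ)‖ / 2) ^ (-s)) :=
          ENNReal.tsum_le_tsum fun k => (hgood₀ k k.2).2.2.2 _
      _ = ENNReal.ofReal (∑' k : {k // k ∉ J₀}, (‖latticePoint (k : Fin d → ℤ)‖ / 2) ^ (-s)) :=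
          (ENNReal.ofReal_tsum_of_nonneg
            (fun k => Real.rpow_nonneg (div_nonneg (norm_nonneg _) zero_le_two) _) (hsum.subtype _)).symm
      _ < 1 := ENNReal.ofReal_lt_one.2 hJ₀'
  · rintro ω ⟨h1, h2⟩
    refine Set.eq_univ_of_forall fun y => ?_
    obtain ⟨k, hk⟩ := exists_norm_sub_latticePoint_le y
    by_cases hkJ : k ∈ J₀
    · have hy : ‖y‖ ≤ L := by
        have := norm_sub_norm_le y (latticePoint k)
        linarith [hL k hkJ]
      obtain ⟨j, hj, hj'⟩ := exists_norm_sub_smul_latticePoint_le hδ0 y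
      have hjJ : j ∈ J := by
        refine hJ j (hj'.trans ?_)
        gcongr
      have h3 : ¬ ∀ i, Z i ω ∉ tileSet δ ε j := Set.mem_iInter.1 h1 ⟨j, hjJ⟩
      obtain ⟨i, hi⟩ := not_forall_not.1 h3
      exact Set.mem_iUnion.2 ⟨i, hB _ _ (mem_ball_of_mem_tileSet hmono hδ0 hε hh0 hδε hj hi)⟩
    · obtain ⟨g1, g2, g3, -⟩ := hgood₀ k hkJ
      have h3 : ¬ ∀ i, Z i ω ∉ S ⟨k, hkJ⟩ := Set.mem_iInter.1 h2 ⟨k, hkJ⟩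
      obtain ⟨i, hi⟩ := not_forall_not.1 h3
      exact Set.mem_iUnion.2 ⟨i, hB _ _ (mem_ball_of_mem_nearCoverSet hmono g1 g2 g3
        (by ring) hk hi)⟩

/-! ### Reduction of the theorem to logarithmic bounds -/

theorem hZero_pow {d : ℕ} (hd : 1 ≤ d) {lam : ℝ} (hlam : 0 < lam) {r : ℝ} (hr : 1 < r) :
    0 < hZero d lam r ^ d ∧ hZero d lam r ^ d = d / (lam * unitBallVolume d) * Real.log r := by
  have hd0 : (0 : ℝ) < d := by exact_mod_cast hd
  have hπ : 0 < unitBallVolume d := unitBallVolume_pos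
  have hlog := Real.log_pos hr
  have h1 : hZero d lam r ^ d = d / (lam * unitBallVolume d) * Real.log r := by
    rw [hZero, ← Real.rpow_natCast, ← Real.rpow_mul (by positivity), one_div_mul_cancel hd0.ne',
      Real.rpow_one]
  exact ⟨h1 ▸ by positivity, h1⟩

theorem theorem1p6 {Ω : Type*} [MeasurableSpace Ω] (P : Measure Ω) [IsProbabilityMeasure P]
    (d : ℕ) (hd : 1 ≤ d) (lam : ℝ) (hlam : 0 < lam)
    (X : ℕ → Ω → EuclideanSpace ℝ (Fin d)) (ρ : ℕ → Ω → ℝ)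
    (hX : IsPoissonPointProcess X (ENNReal.ofReal lam • volume) P)
    (hρ : IsIIDPositiveMarks ρ X P)
    (η : ℝ) (hη : 0 < η) (hmom : Integrable (fun ω => ρ 0 ω ^ ((d : ℝ) + η)) P)
    (h : ℝ → ℝ) (hmono : MonotoneOn h (Set.Ici 0)) (hpos : ∀ r, 0 ≤ r → 0 < h r)
    (B : EuclideanSpace ℝ (Fin d) → ℝ → Set (EuclideanSpace ℝ (Fin d)))
    (hB : B = Metric.ball ∨ B = Metric.closedBall) :
    (((1 / ∫ ω, ρ 0 ω ^ d ∂P : ℝ) : EReal) <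
        liminf (fun r : ℝ => (((h r / hZero d lam r) ^ d : ℝ) : EReal)) atTop →
      0 < P {ω | coveredRegion B h X ρ ω = Set.univ}) ∧
    (limsup (fun r : ℝ => (((h r / hZero d lam r) ^ d : ℝ) : EReal)) atTop <
        ((1 / ∫ ω, ρ 0 ω ^ d ∂P : ℝ) : EReal) →
      P {ω | coveredRegion B h X ρ ω = Set.univ} = 0) := by
  have hd0 : (0 : ℝ) < d := by exact_mod_cast hd
  have hπ : 0 < unitBallVolume d := unitBallVolume_pos
  have hρm := hρ.measurable 0
  have hρ0 := hρ.pos 0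
  have hmomd : Integrable (fun ω => ρ 0 ω ^ d) P := by
    have := integrable_rpow_of_le hρm hρ0 hd0.le (by linarith) hmom
    simpa only [Real.rpow_natCast] using this
  -- Lowering `η` to at most 1 ensures `d * η / (d + η) ≤ 1`, as the power inequalities require.
  have hmin : Integrable (fun ω => ρ 0 ω ^ ((d : ℝ) + min η 1)) P :=
    integrable_rpow_of_le hρm hρ0 (by positivity) (by linarith [min_le_left η 1]) hmom
  have hE : 0 < ∫ ω, ρ 0 ω ^ d ∂P := integral_pow_pos hρ0 hmomd
  have hscale : ∀ c : ℝ, lam * unitBallVolume d * (c * (d / (lam * unitBallVolume d)))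
      * (∫ ω, ρ 0 ω ^ d ∂P) = d * (c * ∫ ω, ρ 0 ω ^ d ∂P) := fun c => by
    field_simp
  constructor
  · intro hlim
    -- A real `c` strictly between also handles an infinite lower limit.
    obtain ⟨c, hc1, hc2⟩ := EReal.lt_iff_exists_real_btwn.1 hlim
    have hc1' : 1 / ∫ ω, ρ 0 ω ^ d ∂P < c := EReal.coe_lt_coe_iff.1 hc1
    have hc0 : 0 < c := (by positivity : 0 < 1 / ∫ ω, ρ 0 ω ^ d ∂P).trans hc1'
    rw [div_lt_iff₀ hE] at hc1'
    refine measure_covered_pos_of_log_bound hd hlam hX hρ hmomd hmono hpos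
      (a := c * (d / (lam * unitBallVolume d))) (by positivity) ?_ ?_ ?_
    · filter_upwards [eventually_lt_of_lt_liminf hc2, eventually_gt_atTop 1] with r hr hr1
      obtain ⟨h1, h2⟩ := hZero_pow hd hlam hr1
      have h3 := EReal.coe_lt_coe_iff.1 hr
      rw [div_pow, lt_div_iff₀ h1, h2] at h3
      linarith
    · rw [hscale]
      nlinarith
    · rcases hB with rfl | rfl
      · exact fun x r => subset_rfl
      · exact fun x r => Metric.ball_subset_closedBall
  · intro hlim
    obtain ⟨c, hc1, hc2⟩ := EReal.lt_iff_exists_real_btwn.1 hlim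
    have hc2' : c < 1 / ∫ ω, ρ 0 ω ^ d ∂P := EReal.coe_lt_coe_iff.1 hc2
    rw [lt_div_iff₀ hE] at hc2'
    have hev : ∀ᶠ r in atTop, h r ^ d < c * (d / (lam * unitBallVolume d)) * Real.log r := by
      filter_upwards [eventually_lt_of_limsup_lt hc1, eventually_gt_atTop 1] with r hr hr1
      obtain ⟨h1, h2⟩ := hZero_pow hd hlam hr1
      have h3 := EReal.coe_lt_coe_iff.1 hr
      rw [div_pow, div_lt_iff₀ h1, h2] at h3
      linarith
    obtain ⟨r₀, hr₀⟩ := eventually_atTop.1 (hev.and (eventually_gt_atTop 1))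
    have hr1 := (hr₀ r₀ le_rfl).2
    -- Positivity of `c` is forced by `h r₀ > 0` and `log r₀ > 0`.
    have ha : 0 < c * (d / (lam * unitBallVolume d)) := by
      have h1 := (pow_pos (hpos r₀ (by linarith)) d).trans (hr₀ r₀ le_rfl).1
      exact pos_of_mul_pos_left h1 (Real.log_pos hr1).le
    refine measure_covered_eq_zero_of_log_bound hd hlam hX hρ (η := min η 1) (by positivity)
      (min_le_right _ _) hmin hmomd (K := h r₀ ^ d) (pow_nonneg (hpos r₀ (by linarith)).le d) ha
      ?_ ?_ ?_
    -- Up to `r₀` the constant `h r₀ ^ d` suffices by monotonicity; beyond it the logarithmic term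
    -- does.
    · intro r hr
      have hh := hpos r₀ (by linarith)
      rcases le_total r r₀ with hrr | hrr
      · have h1 : h r ^ d ≤ h r₀ ^ d :=
          pow_le_pow_left₀ (hpos r hr).le (hmono hr (hr.trans hrr) hrr) d
        have h2 : 0 ≤ Real.log (1 + r) := Real.log_nonneg (by linarith)
        have := mul_nonneg ha.le h2
        linarith
      · have h1 := (hr₀ r hrr).1
        have h2 : Real.log r ≤ Real.log (1 + r) := Real.log_le_log (by linarith) (by linarith)
        have := mul_le_mul_of_nonneg_left h2 ha.le
        have := pow_pos hh d
        linarith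
    · rw [hscale]
      nlinarith
    · rcases hB with rfl | rfl
      · exact fun x r => Metric.ball_subset_closedBall
      · exact fun x r => subset_rfl
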